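/- Let $\mathbbm{k}$ be a field. Let $T=T^2_0$ be the $\mathbbm{k}$-algebra of Stendhal diagrams with two red strands and one black strand: it is spanned by diagrams of downward oriented curves in $\mathbb{R}\times[0,1]$ (up to isotopy) in which the black strand may cross the red strands and may carry dots while the red strands do not cross each other; the product is stacking (zero if the colours do not match); dots slide freely through red/black crossings; a black strand that crosses a red strand and immediately crosses back equals the uncrossed pair of strands with one dot on the black strand; and every diagram having a horizontal slice whose leftmost strand is black is zero. Let $e$ be the idempotent given by the vertical strands red, black, red, let $P=Te$, and let $L_1$ be the quotient of the left module $P$ by its radical (the intersection of its maximal submodules); $L_1$ is simple. Let $\operatorname{Ext}^\bullet(L_1,L_1)=\bigoplus_{n\ge 0}\operatorname{Ext}^n_T(L_1,L_1)$, a graded algebra under the Yoneda product. Its dual $\operatorname{Ext}^\bullet(L_1,L_1)^*$ is a coalgebra, with the transposed structure maps. There is an isomorphism of functors $\mathbb{R}\!\operatorname{Hom}_T(L_1,-)[2]\cong\mathbb{R}\!\operatorname{Hom}_T(-,L_1)^*$ on the bounded derived category of finitely generated $T$-modules. Here this means: for all finitely generated $M$ there are isomorphisms $\theta_M\colon\operatorname{Ext}^i(L_1,M)\to\operatorname{Ext}^{2-i}(M,L_1)^*$,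 $0\le i\le 2$, which satisfy $\theta_N(fa)(b)=\theta_M(a)(bf)$ for all $f\in\operatorname{Ext}^p(M,N)$, $a\in\operatorname{Ext}^i(L_1,M)$ and $b\in\operatorname{Ext}^{2-i-p}(N,L_1)$, and $\operatorname{Ext}^i(L_1,M)=\operatorname{Ext}^i(M,L_1)=0$ for $i>2$. For every such $\theta$, the map $\theta_{L_1}$ identifies the algebra $\operatorname{Ext}^\bullet(L_1,L_1)$ with the coalgebra $\operatorname{Ext}^\bullet(L_1,L_1)^*$ and so makes it a Frobenius algebra, with counit $a\mapsto\theta_{L_1}(a)(\mathrm{id})$ on $\operatorname{Ext}^2$ and $0$ in the other degrees. With each of these structures, the Frobenius algebra $\operatorname{Ext}^\bullet(L_1,L_1)$ is isomorphic to $H^*(S^2;\mathbbm{k})$ with its Poincaré Frobenius structure. That is, let $H^*(S^2;\mathbbm{k})$ be the simplicial cohomology of $S^2$, triangulated as the boundary of a tetrahedron (whose geometric realization is homeomorphic to the unit sphere in $\mathbb{R}^3$), with the cup product, with the counit given by evaluation on the fundamental class, and with the comultiplication that corresponds to the transpose of the cup product under Poincaré duality. Then there is an isomorphism of $\mathbbm{k}$-algebras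 $\operatorname{Ext}^\bullet(L_1,L_1)\to H^*(S^2;\mathbbm{k})$ that maps $\operatorname{Ext}^n(L_1,L_1)$ to $H^n(S^2;\mathbbm{k})$ for every $n$ and is compatible with the counits and the comultiplications. -/

import Mathlib

open CategoryTheory CategoryTheory.Abelian
open scoped TensorProduct DirectSum

universe u

noncomputable section

/-! ### Stendhal diagrams and the algebras they span -/

/-- The two kinds of strands of a Stendhal diagram. -/
inductive Strand : Type
  | red : Strand
  | black : Strand
  deriving DecidableEq

instance : Fintype Strand :=
  ⟨{Strand.red, Strand.black}, fun x => by cases x <;> simp⟩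

/-- A generic horizontal slice of a Stendhal diagram with `ℓ` red and `b` black strands: the
colours of the strands met by the slice, read from left to right. -/
abbrev Slice (ℓ b : ℕ) : Type :=
  {s : Fin (ℓ + b) → Strand // (Finset.univ.filter fun i => s i = Strand.black).card = b}

namespace Slice

/-- The colour of the strand in position `i`. -/
def color {ℓ b : ℕ} (s : Slice ℓ b) (i : Fin (ℓ + b)) : Strand := s.1 i

/-- The slice in which the strands in positions `i` and `j` have been exchanged. -/
def swap {ℓ b : ℕ} (s : Slice ℓ b) (i j : Fin (ℓ + b)) : Slice ℓ b :=
  ⟨fun x => s.1 (Equiv.swap i j x), by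
    refine Eq.trans ?_ s.2
    exact Finset.card_equiv (Equiv.swap i j) fun x => by simp⟩

end Slice

/-- Elementary Stendhal diagrams: vertical strands; vertical strands with one dot in position `i`;
a single crossing of the strands in the neighbouring positions `i`, `j = i + 1`. The slice is the
one at the bottom of the diagram. -/
inductive Elementary (ℓ b : ℕ) : Type
  | idem (s : Slice ℓ b) : Elementary ℓ b
  | dot (s : Slice ℓ b) (i : Fin (ℓ + b)) : Elementary ℓ b
  | cross (s : Slice ℓ b) (i j : Fin (ℓ + b)) (h : (i : ℕ) + 1 = j) : Elementary ℓ b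

namespace Stendhal

variable (k : Type u) [Field k] {ℓ b : ℕ}

/-- Formal combinations of stacks of elementary diagrams; in a product `x * y` the diagram `x`
is stacked on top of `y`. -/
abbrev Stack (ℓ b : ℕ) : Type u := FreeAlgebra k (Elementary ℓ b)

/-- The diagram of vertical strands. -/
abbrev idem (s : Slice ℓ b) : Stack k ℓ b := FreeAlgebra.ι k (Elementary.idem s)

/-- The diagram of vertical strands with one dot. -/
abbrev dot (s : Slice ℓ b) (i : Fin (ℓ + b)) : Stack k ℓ b :=
  FreeAlgebra.ι k (Elementary.dot s i)

/-- The diagram with one crossing. -/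
abbrev cross (s : Slice ℓ b) (i j : Fin (ℓ + b)) (h : (i : ℕ) + 1 = j) : Stack k ℓ b :=
  FreeAlgebra.ι k (Elementary.cross s i j h)

/-- Three neighbouring strands, the outer two of which are exchanged while the middle one passes
to the left of their crossing. -/
abbrev tripleLeft (s : Slice ℓ b) (i j l : Fin (ℓ + b)) (hij : (i : ℕ) + 1 = j)
    (hjl : (j : ℕ) + 1 = l) : Stack k ℓ b :=
  cross k ((s.swap i j).swap j l) i j hij * cross k (s.swap i j) j l hjl * cross k s i j hij

/-- Three neighbouring strands, the outer two of which are exchanged while the middle one passes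
to the right of their crossing. -/
abbrev tripleRight (s : Slice ℓ b) (i j l : Fin (ℓ + b)) (hij : (i : ℕ) + 1 = j)
    (hjl : (j : ℕ) + 1 = l) : Stack k ℓ b :=
  cross k ((s.swap j l).swap i j) j l hjl * cross k (s.swap j l) i j hij * cross k s j l hjl

/-- The relations of the algebra of Stendhal diagrams. The first group says that stacking is only
possible along equal slices, that red strands carry no dots and that red strands do not cross; the
second group is isotopy; the third group consists of the local relations. -/
inductive Rel (ℓ b : ℕ) : Stack k ℓ b → Stack k ℓ b → Prop
  | idem_mul_idem (s t : Slice ℓ b) : Rel ℓ b (idem k s * idem k t) (if s = t then idem k s else 0)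
  | sum_idem : Rel ℓ b (∑ s : Slice ℓ b, idem k s) 1
  | dot_bottom (s : Slice ℓ b) (i : Fin (ℓ + b)) : Rel ℓ b (dot k s i * idem k s) (dot k s i)
  | dot_top (s : Slice ℓ b) (i : Fin (ℓ + b)) : Rel ℓ b (idem k s * dot k s i) (dot k s i)
  | cross_bottom (s : Slice ℓ b) (i j : Fin (ℓ + b)) (h : (i : ℕ) + 1 = j) :
      Rel ℓ b (cross k s i j h * idem k s) (cross k s i j h)
  | cross_top (s : Slice ℓ b) (i j : Fin (ℓ + b)) (h : (i : ℕ) + 1 = j) :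
      Rel ℓ b (idem k (s.swap i j) * cross k s i j h) (cross k s i j h)
  | dot_red (s : Slice ℓ b) (i : Fin (ℓ + b)) (hi : s.color i = Strand.red) :
      Rel ℓ b (dot k s i) 0
  | cross_red (s : Slice ℓ b) (i j : Fin (ℓ + b)) (h : (i : ℕ) + 1 = j)
      (hi : s.color i = Strand.red) (hj : s.color j = Strand.red) :
      Rel ℓ b (cross k s i j h) 0
  | dot_comm_dot (s : Slice ℓ b) (i j : Fin (ℓ + b)) :
      Rel ℓ b (dot k s i * dot k s j) (dot k s j * dot k s i)
  | cross_comm_dot (s : Slice ℓ b) (i j : Fin (ℓ + b)) (h : (i : ℕ) + 1 = j) (l : Fin (ℓ + b))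
      (hi : l ≠ i) (hj : l ≠ j) :
      Rel ℓ b (cross k s i j h * dot k s l) (dot k (s.swap i j) l * cross k s i j h)
  | cross_comm_cross (s : Slice ℓ b) (i j i' j' : Fin (ℓ + b)) (h : (i : ℕ) + 1 = j)
      (h' : (i' : ℕ) + 1 = j') (hd : j < i') :
      Rel ℓ b (cross k (s.swap i' j') i j h * cross k s i' j' h')
        (cross k (s.swap i j) i' j' h' * cross k s i j h)
  | nilHecke_top (s : Slice ℓ b) (i j : Fin (ℓ + b)) (h : (i : ℕ) + 1 = j)
      (hi : s.color i = Strand.black) (hj : s.color j = Strand.black) :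
      Rel ℓ b (dot k s i * cross k s i j h) (cross k s i j h * dot k s j - idem k s)
  | nilHecke_bottom (s : Slice ℓ b) (i j : Fin (ℓ + b)) (h : (i : ℕ) + 1 = j)
      (hi : s.color i = Strand.black) (hj : s.color j = Strand.black) :
      Rel ℓ b (cross k s i j h * dot k s i) (dot k s j * cross k s i j h - idem k s)
  | black_bigon (s : Slice ℓ b) (i j : Fin (ℓ + b)) (h : (i : ℕ) + 1 = j)
      (hi : s.color i = Strand.black) (hj : s.color j = Strand.black) :
      Rel ℓ b (cross k s i j h * cross k s i j h) 0
  | black_triple (s : Slice ℓ b) (i j l : Fin (ℓ + b)) (hij : (i : ℕ) + 1 = j)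
      (hjl : (j : ℕ) + 1 = l) (hi : s.color i = Strand.black) (hj : s.color j = Strand.black)
      (hl : s.color l = Strand.black) :
      Rel ℓ b (tripleLeft k s i j l hij hjl) (tripleRight k s i j l hij hjl)
  | red_middle_triple (s : Slice ℓ b) (i j l : Fin (ℓ + b)) (hij : (i : ℕ) + 1 = j)
      (hjl : (j : ℕ) + 1 = l) (hi : s.color i = Strand.black) (hj : s.color j = Strand.red)
      (hl : s.color l = Strand.black) :
      Rel ℓ b (tripleLeft k s i j l hij hjl) (tripleRight k s i j l hij hjl - idem k s)
  | red_right_triple (s : Slice ℓ b) (i j l : Fin (ℓ + b)) (hij : (i : ℕ) + 1 = j)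
      (hjl : (j : ℕ) + 1 = l) (hi : s.color i = Strand.black) (hj : s.color j = Strand.black)
      (hl : s.color l = Strand.red) :
      Rel ℓ b (tripleLeft k s i j l hij hjl) (tripleRight k s i j l hij hjl)
  | red_left_triple (s : Slice ℓ b) (i j l : Fin (ℓ + b)) (hij : (i : ℕ) + 1 = j)
      (hjl : (j : ℕ) + 1 = l) (hi : s.color i = Strand.red) (hj : s.color j = Strand.black)
      (hl : s.color l = Strand.black) :
      Rel ℓ b (tripleLeft k s i j l hij hjl) (tripleRight k s i j l hij hjl)
  | red_right_dot (s : Slice ℓ b) (i j : Fin (ℓ + b)) (h : (i : ℕ) + 1 = j)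
      (hi : s.color i = Strand.black) (hj : s.color j = Strand.red) :
      Rel ℓ b (cross k s i j h * dot k s i) (dot k (s.swap i j) j * cross k s i j h)
  | red_left_dot (s : Slice ℓ b) (i j : Fin (ℓ + b)) (h : (i : ℕ) + 1 = j)
      (hi : s.color i = Strand.red) (hj : s.color j = Strand.black) :
      Rel ℓ b (cross k s i j h * dot k s j) (dot k (s.swap i j) i * cross k s i j h)
  | red_right_bigon (s : Slice ℓ b) (i j : Fin (ℓ + b)) (h : (i : ℕ) + 1 = j)
      (hi : s.color i = Strand.black) (hj : s.color j = Strand.red) :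
      Rel ℓ b (cross k (s.swap i j) i j h * cross k s i j h) (dot k s i)
  | red_left_bigon (s : Slice ℓ b) (i j : Fin (ℓ + b)) (h : (i : ℕ) + 1 = j)
      (hi : s.color i = Strand.red) (hj : s.color j = Strand.black) :
      Rel ℓ b (cross k (s.swap i j) i j h * cross k s i j h) (dot k s j)
  | violating (s : Slice ℓ b) (i : Fin (ℓ + b)) (h : (i : ℕ) = 0)
      (hi : s.color i = Strand.black) : Rel ℓ b (idem k s) 0

end Stendhal

/-- The algebra `T^ℓ_{ℓ - 2b}` of Stendhal diagrams with `ℓ` red and `b` black strands. -/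
def StendhalAlgebra (k : Type u) [Field k] (ℓ b : ℕ) : Type u :=
  RingQuot (Stendhal.Rel k ℓ b)

namespace StendhalAlgebra

variable (k : Type u) [Field k] (ℓ b : ℕ)

instance : Ring (StendhalAlgebra k ℓ b) :=
  inferInstanceAs (Ring (RingQuot (Stendhal.Rel k ℓ b)))

instance : Algebra k (StendhalAlgebra k ℓ b) :=
  inferInstanceAs (Algebra k (RingQuot (Stendhal.Rel k ℓ b)))

variable {ℓ b} in
/-- The idempotent of a slice. -/
def idem (s : Slice ℓ b) : StendhalAlgebra k ℓ b :=
  RingQuot.mkAlgHom k (Stendhal.Rel k ℓ b) (Stendhal.idem k s)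

variable {ℓ b} in
/-- The left module spanned by the diagrams with bottom `s`. -/
abbrev projective (s : Slice ℓ b) : Submodule (StendhalAlgebra k ℓ b) (StendhalAlgebra k ℓ b) :=
  Submodule.span (StendhalAlgebra k ℓ b) {idem k s}

end StendhalAlgebra

/-- The algebra `T^2_0`: two red strands and one black strand. -/
abbrev T20 (k : Type u) [Field k] : Type u := StendhalAlgebra k 2 1

/-- The slice red, black, red; no black strand is left of the first red strand, and one is left of
the second. -/
def slice01 : Slice 2 1 :=
  ⟨![Strand.red, Strand.black, Strand.red], by decide⟩

/-- The module `L₁`: the quotient of the projective module of the slice red, black, red by its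
radical, the intersection of its maximal submodules. -/
def L₁ (k : Type u) [Field k] : ModuleCat.{u} (T20 k) :=
  ModuleCat.of (T20 k) (StendhalAlgebra.projective k slice01 ⧸
    Module.jacobson (T20 k) (StendhalAlgebra.projective k slice01))

/-! ### Frobenius structures -/

/-- `ε` and `Δ` are the counit and the comultiplication of a Frobenius structure on the algebra `A`:
`a ↦ ε (a * -)` identifies `A` with its dual space, and under this identification `Δ` is the
comultiplication of the dual space that is transposed to the multiplication of `A`
(and `ε` is its counit, the evaluation at `1`). -/
structure IsFrobenius (k : Type*) [Field k] {A : Type*} [Ring A] [Algebra k A] (ε : A →ₗ[k] k)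
    (Δ : A →ₗ[k] A ⊗[k] A) : Prop where
  perfect : Function.Bijective fun a : A => ε ∘ₗ LinearMap.mulLeft k a
  comul_dual : ∀ a x y : A,
    LinearMap.mul' k k (TensorProduct.map (ε ∘ₗ LinearMap.mulRight k x)
      (ε ∘ₗ LinearMap.mulRight k y) (Δ a)) = ε (a * (x * y))

/-! ### The Ext-algebra of `L₁` and its Frobenius structure -/

/-- The space `Ext^n(L₁, L₁)` over `T^2_0`. -/
def ExtSpace (k : Type u) [Field k] (n : ℕ) : Type u := Ext.{u} (L₁ k) (L₁ k) n

namespace ExtSpace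

variable (k : Type u) [Field k]

instance (n : ℕ) : AddCommGroup (ExtSpace k n) := inferInstanceAs (AddCommGroup (Ext.{u} _ _ n))

instance (n : ℕ) : Module k (ExtSpace k n) := inferInstanceAs (Module k (Ext.{u} _ _ n))

/-- The unit of the Ext-algebra: the identity of `L₁`. -/
instance : GradedMonoid.GOne (ExtSpace k) where
  one := Ext.mk₀ (𝟙 (L₁ k))

/-- The Yoneda product, written in the order of composition of arrows. -/
instance : GradedMonoid.GMul (ExtSpace k) where
  mul {i j} a b := Ext.comp (c := i + j) a b rfl

variable {k} in
theorem mk_comp {i j n : ℕ} (a : Ext.{u} (L₁ k) (L₁ k) i) (b : Ext.{u} (L₁ k) (L₁ k) j)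
    (h : i + j = n) :
    GradedMonoid.mk (A := ExtSpace k) (i + j) (GradedMonoid.GMul.mul (A := ExtSpace k) a b) =
      GradedMonoid.mk (A := ExtSpace k) n (a.comp b h) := by
  subst h
  rfl

instance : GradedMonoid.GMonoid (ExtSpace k) where
  one_mul := by
    rintro ⟨n, a⟩
    exact (mk_comp _ _ (zero_add n)).trans (congrArg _ (Ext.mk₀_id_comp _))
  mul_one := by
    rintro ⟨n, a⟩
    exact (mk_comp _ _ (add_zero n)).trans (congrArg _ (Ext.comp_mk₀_id _))
  mul_assoc := by
    rintro ⟨i, a⟩ ⟨j, b⟩ ⟨l, c⟩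
    exact (mk_comp _ _ (add_assoc i j l)).trans 
      (congrArg _ (Ext.comp_assoc a b c rfl rfl (add_assoc i j l)))

instance : DirectSum.GRing (ExtSpace k) where
  mul_zero _ := Ext.comp_zero _ _ _ _ _
  zero_mul _ := Ext.zero_comp _ _ _ _ _
  mul_add _ _ _ := Ext.comp_add _ _ _ _
  add_mul _ _ _ := Ext.add_comp _ _ _ _
  natCast n := n • GradedMonoid.GOne.one
  natCast_zero := zero_smul _ _
  natCast_succ n := succ_nsmul _ n
  intCast n := n • GradedMonoid.GOne.one
  intCast_ofNat n := natCast_zsmul _ n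
  intCast_negSucc_ofNat n := negSucc_zsmul _ n

instance : DirectSum.GAlgebra k (ExtSpace k) where
  toFun :=
    { toFun := fun r => r • GradedMonoid.GOne.one
      map_zero' := zero_smul _ _
      map_add' := fun r s => add_smul r s _ }
  map_one := one_smul _ _
  map_mul r s := by
    refine ((mk_comp _ _ (zero_add 0)).trans (congrArg _ ?_)).symm
    exact (Ext.smul_comp _ _ _ r).trans
      ((congrArg (r • ·) (Ext.mk₀_id_comp _)).trans (smul_smul r s _))
  commutes := by
    rintro r ⟨n, a⟩
    refine (mk_comp _ _ (zero_add n)).trans (Eq.trans (congrArg _ ?_)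
      (mk_comp _ _ (add_zero n)).symm)
    exact (Ext.smul_comp _ _ _ r).trans ((congrArg (r • ·) ((Ext.mk₀_id_comp _).trans
      (Ext.comp_mk₀_id _).symm)).trans (Ext.comp_smul _ _ _ r).symm)
  smul_def := by
    rintro r ⟨n, a⟩
    refine Eq.trans (congrArg (GradedMonoid.mk n) ?_) (mk_comp _ _ (zero_add n)).symm
    exact (congrArg (r • ·) (Ext.mk₀_id_comp _).symm).trans (Ext.smul_comp _ _ _ r).symm

end ExtSpace

/-- The algebra `Ext^•(L₁, L₁)` with the Yoneda product. -/
abbrev ExtAlgebra (k : Type u) [Field k] : Type u := ⨁ n : ℕ, ExtSpace k n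

/-- An isomorphism `RHom(L₁, -)[2] ≅ RHom(-, L₁)^*` of functors on the bounded derived category of
finitely generated `T^2_0`-modules, given on cohomology: isomorphisms
`Ext^i(L₁, M) ≅ Ext^j(M, L₁)^*`, `i + j = 2`, that are compatible with morphisms
`M → N[p]` of all degrees, all other Ext-spaces being zero. -/
structure ExtDuality (k : Type u) [Field k] where
  iso (M : ModuleCat.{u} (T20 k)) [Module.Finite (T20 k) M] (i j : ℕ) (h : i + j = 2) :
    Ext.{u} (L₁ k) M i ≃ₗ[k] Module.Dual k (Ext.{u} M (L₁ k) j)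
  natural (M N : ModuleCat.{u} (T20 k)) [Module.Finite (T20 k) M] [Module.Finite (T20 k) N]
    (i p j i' j' : ℕ) (hi : i + p = i') (hj : p + j = j') (h : i + j' = 2) (h' : i' + j = 2)
    (a : Ext.{u} (L₁ k) M i) (f : Ext.{u} M N p) (b : Ext.{u} N (L₁ k) j) :
    iso N i' j h' (a.comp f hi) b = iso M i j' h a (f.comp b hj)
  vanish_left (M : ModuleCat.{u} (T20 k)) [Module.Finite (T20 k) M] (i : ℕ) (hi : 2 < i) :
    Subsingleton (Ext.{u} (L₁ k) M i)
  vanish_right (M : ModuleCat.{u} (T20 k)) [Module.Finite (T20 k) M] (j : ℕ) (hj : 2 < j) :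
    Subsingleton (Ext.{u} M (L₁ k) j)

instance (k : Type u) [Field k] : Module.Finite (T20 k) (L₁ k) := by
  have : Module.Finite (T20 k) (StendhalAlgebra.projective k slice01) :=
    Module.Finite.iff_fg.mpr ⟨{StendhalAlgebra.idem k slice01}, by simp⟩
  exact inferInstanceAs (Module.Finite (T20 k) (StendhalAlgebra.projective k slice01 ⧸
    Module.jacobson (T20 k) (StendhalAlgebra.projective k slice01)))

/-- The counit of the Ext-algebra: the identification of `Ext^•(L₁, L₁)` with the dual coalgebra
`Ext^•(L₁, L₁)^*`, followed by the counit of the latter, the evaluation at the identity. -/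
def ExtDuality.counit {k : Type u} [Field k] (θ : ExtDuality k) : ExtAlgebra k →ₗ[k] k :=
  LinearMap.applyₗ (R := k) (M := ExtSpace k 0) (GradedMonoid.GOne.one : ExtSpace k 0) ∘ₗ
    (θ.iso (L₁ k) 2 0 rfl).toLinearMap ∘ₗ DirectSum.component k ℕ (ExtSpace k) 2

/-! ### Simplicial cohomology -/

namespace SimplicialCohomology

variable {V : Type*} (K : PreAbstractSimplicialComplex V) (k : Type u) [Field k]

/-- The functions supported on the faces of `K` with `m` vertices. So the `n`-cochains of `K` are
`cochains K k (n + 1)`, and `cochains K k 0` is zero. -/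
def cochains (m : ℕ) : Submodule k (Finset V → k) where
  carrier := {f | ∀ s, f s ≠ 0 → s ∈ K ∧ s.card = m}
  add_mem' {f g} hf hg s hs := by
    by_cases h : f s = 0
    · exact hg s fun h' => hs (by simp [h, h'])
    · exact hf s h
  zero_mem' s hs := absurd rfl hs
  smul_mem' c f hf s hs := hf s fun h => hs (by simp [h])

variable [LinearOrder V]

open Classical in
/-- The coboundary, `(d f)[v₀, …, vₙ] = ∑ i, (-1)^i f[v₀, …, v̂ᵢ, …, vₙ]` for `v₀ < ⋯ < vₙ`. -/
def coboundary : (Finset V → k) →ₗ[k] (Finset V → k) where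
  toFun f s := if s ∈ K then
    ∑ v ∈ s, (-1) ^ (s.filter (· < v)).card * f (s.erase v) else 0
  map_add' f g := by
    ext s
    by_cases h : s ∈ K <;> simp [h, mul_add, Finset.sum_add_distrib]
  map_smul' c f := by
    ext s
    by_cases h : s ∈ K <;> simp [h, Finset.mul_sum, mul_left_comm]

open Classical in
/-- The cup product,
`(f ∪ g)[v₀, …, vₙ] = ∑ i, f[v₀, …, vᵢ] g[vᵢ, …, vₙ]` for `v₀ < ⋯ < vₙ`; for a `p`-cochain `f`
and a `q`-cochain `g` only `n = p + q`, `i = p` contributes. -/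
def cup : (Finset V → k) →ₗ[k] (Finset V → k) →ₗ[k] (Finset V → k) :=
  LinearMap.mk₂ k (fun f g s => if s ∈ K then
    ∑ v ∈ s, f (s.filter (· ≤ v)) * g (s.filter (v ≤ ·)) else 0)
    (fun f g h => by
      ext s
      by_cases hs : s ∈ K <;> simp [hs, add_mul, Finset.sum_add_distrib])
    (fun c f g => by
      ext s
      by_cases hs : s ∈ K <;> simp [hs, Finset.mul_sum, mul_assoc])
    (fun f g h => by
      ext s
      by_cases hs : s ∈ K <;> simp [hs, mul_add, Finset.sum_add_distrib])
    (fun c f g => by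
      ext s
      by_cases hs : s ∈ K <;> simp [hs, Finset.mul_sum, mul_left_comm])

open Classical in
/-- The `0`-cochain with value `1` on every vertex. -/
def unit : Finset V → k := fun s => if s ∈ K ∧ s.card = 1 then 1 else 0

/-- The `n`-cocycles. -/
def cocycles (n : ℕ) : Submodule k (Finset V → k) :=
  cochains K k (n + 1) ⊓ LinearMap.ker (coboundary K k)

/-- The `n`-coboundaries. -/
def coboundaries (n : ℕ) : Submodule k (Finset V → k) :=
  (cochains K k n).map (coboundary K k)

end SimplicialCohomology

open SimplicialCohomology in
/-- The simplicial cohomology space `H^n(K; k)` of a simplicial complex with ordered vertices. -/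
def SimplicialH {V : Type*} [LinearOrder V] (K : PreAbstractSimplicialComplex V) (k : Type u)
    [Field k] (n : ℕ) : Type _ :=
  cocycles K k n ⧸ (coboundaries K k n).submoduleOf (cocycles K k n)

namespace SimplicialCohomology

variable {V : Type*} {K : PreAbstractSimplicialComplex V} {k : Type u} [Field k]

theorem mem_of_subset {s t : Finset V} (hs : s ∈ K) (hts : t ⊆ s) (ht : t.Nonempty) : t ∈ K :=
  (K.isRelLowerSet_faces hs).2 hts ht

theorem cochains_empty {m : ℕ} {f : Finset V → k} (hf : f ∈ cochains K k m) : f ∅ = 0 := by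
  by_contra h
  exact (K.isRelLowerSet_faces (hf ∅ h).1).1.ne_empty rfl

variable [LinearOrder V]

theorem coboundary_apply {f : Finset V → k} {s : Finset V} (hs : s ∈ K) :
    coboundary K k f s = ∑ v ∈ s, (-1) ^ (s.filter (· < v)).card * f (s.erase v) := by
  simp [coboundary, hs]

theorem coboundary_of_notMem {f : Finset V → k} {s : Finset V} (hs : s ∉ K) :
    coboundary K k f s = 0 := by
  simp [coboundary, hs]

theorem cup_apply {f g : Finset V → k} {s : Finset V} (hs : s ∈ K) :
    cup K k f g s = ∑ v ∈ s, f (s.filter (· ≤ v)) * g (s.filter (v ≤ ·)) := by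
  simp [cup, hs]

theorem cup_of_notMem {f g : Finset V → k} {s : Finset V} (hs : s ∉ K) :
    cup K k f g s = 0 := by
  simp [cup, hs]

theorem filter_le_mem {s : Finset V} (hs : s ∈ K) {v : V} (hv : v ∈ s) : s.filter (· ≤ v) ∈ K :=
  mem_of_subset hs (Finset.filter_subset _ _) ⟨v, by simp [hv]⟩

theorem filter_ge_mem {s : Finset V} (hs : s ∈ K) {v : V} (hv : v ∈ s) : s.filter (v ≤ ·) ∈ K :=
  mem_of_subset hs (Finset.filter_subset _ _) ⟨v, by simp [hv]⟩

theorem card_filter_add {s : Finset V} {v : V} (hv : v ∈ s) :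
    (s.filter (· ≤ v)).card + (s.filter (v ≤ ·)).card = s.card + 1 := by
  rw [← Finset.card_union_add_card_inter]
  congr 1
  · congr 1
    ext x
    have := le_total x v
    simp only [Finset.mem_union, Finset.mem_filter]
    tauto
  · rw [Finset.card_eq_one]
    refine ⟨v, ?_⟩
    ext x
    simp only [Finset.mem_inter, Finset.mem_filter, Finset.mem_singleton]
    constructor
    · rintro ⟨⟨_, h1⟩, _, h2⟩
      exact le_antisymm h1 h2
    · rintro rfl
      exact ⟨⟨hv, le_rfl⟩, hv, le_rfl⟩

theorem cup_mem_cochains {p q : ℕ} {f g : Finset V → k} (hf : f ∈ cochains K k p)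
    (hg : g ∈ cochains K k q) {n : ℕ} (hn : p + q = n + 1) : cup K k f g ∈ cochains K k n := by
  intro s hs
  by_cases h : s ∈ K
  · refine ⟨h, ?_⟩
    rw [cup_apply h] at hs
    obtain ⟨v, hv, hne⟩ := Finset.exists_ne_zero_of_sum_ne_zero hs
    have h1 := (hf _ (left_ne_zero_of_mul hne)).2
    have h2 := (hg _ (right_ne_zero_of_mul hne)).2
    have h3 := card_filter_add hv
    omega
  · exact absurd (cup_of_notMem h) hs

theorem telescope (F : Finset V → k) (s : Finset V) :
    ∑ v ∈ s, (-1) ^ (s.filter (· < v)).card * (F (s.filter (· < v)) + F (s.filter (· ≤ v))) =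
      F ∅ - (-1) ^ s.card * F s := by
  induction s using Finset.induction_on_max with
  | empty => simp
  | insert m s hm ih =>
    have hms : m ∉ s := fun h => lt_irrefl _ (hm m h)
    rw [Finset.sum_insert hms, Finset.card_insert_of_notMem hms]
    have e1 : (insert m s).filter (· < m) = s := by
      ext x
      simp only [Finset.mem_filter, Finset.mem_insert]
      constructor
      · rintro ⟨rfl | h, h'⟩
        · exact absurd h' (lt_irrefl _)
        · exact h
      · exact fun h => ⟨Or.inr h, hm x h⟩
    have e2 : (insert m s).filter (· ≤ m) = insert m s := by
      refine Finset.filter_true_of_mem fun x hx => ?_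
      rcases Finset.mem_insert.mp hx with rfl | h
      · exact le_rfl
      · exact (hm x h).le
    have e3 : ∀ v ∈ s, (insert m s).filter (· < v) = s.filter (· < v) := fun v hv => by
      rw [Finset.filter_insert, if_neg (hm v hv).not_gt]
    have e4 : ∀ v ∈ s, (insert m s).filter (· ≤ v) = s.filter (· ≤ v) := fun v hv => by
      rw [Finset.filter_insert, if_neg (hm v hv).not_ge]
    rw [e1, e2, Finset.sum_congr rfl fun v hv => by rw [e3 v hv, e4 v hv], ih]
    ring

theorem cup_erase {f g : Finset V → k} {s : Finset V} (hs : s ∈ K) (v : V) :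
    cup K k f g (s.erase v) = ∑ w ∈ s.erase v,
      f ((s.erase v).filter (· ≤ w)) * g ((s.erase v).filter (w ≤ ·)) := by
  rcases (s.erase v).eq_empty_or_nonempty with h | h
  · rw [h, cup_of_notMem, Finset.sum_empty]
    exact fun h' => (K.isRelLowerSet_faces h').1.ne_empty rfl
  · exact cup_apply (mem_of_subset hs (Finset.erase_subset _ _) h)

theorem sum_erase_split (F : V → k) {s : Finset V} (w : V) :
    ∑ v ∈ s.erase w, F v = ∑ v ∈ s.filter (· < w), F v + ∑ v ∈ s.filter (w < ·), F v := by
  rw [← Finset.sum_union]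
  · congr 1
    ext x
    simp only [Finset.mem_erase, Finset.mem_union, Finset.mem_filter, ← and_or_left,
      lt_or_lt_iff_ne]
    tauto
  · exact Finset.disjoint_filter.mpr fun x _ h => h.le.not_gt

theorem sum_filter_le_split (F : V → k) {s : Finset V} {w : V} (hw : w ∈ s) :
    ∑ v ∈ s.filter (· ≤ w), F v = ∑ v ∈ s.filter (· < w), F v + F w := by
  have : s.filter (· ≤ w) = insert w (s.filter (· < w)) := by
    ext x
    simp only [Finset.mem_filter, Finset.mem_insert, le_iff_lt_or_eq]
    constructor
    · tauto
    · rintro (rfl | h)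
      · exact ⟨hw, Or.inr rfl⟩
      · tauto
  rw [this, Finset.sum_insert (by simp), add_comm]

theorem sum_filter_ge_split (F : V → k) {s : Finset V} {w : V} (hw : w ∈ s) :
    ∑ v ∈ s.filter (w ≤ ·), F v = F w + ∑ v ∈ s.filter (w < ·), F v := by
  have : s.filter (w ≤ ·) = insert w (s.filter (w < ·)) := by
    ext x
    simp only [Finset.mem_filter, Finset.mem_insert, le_iff_lt_or_eq]
    constructor
    · rintro ⟨h, h' | rfl⟩ <;> tauto
    · rintro (rfl | h)
      · exact ⟨hw, Or.inr rfl⟩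
      · tauto
  rw [this, Finset.sum_insert (by simp)]

/-- The Leibniz rule. -/
theorem coboundary_cup {p q : ℕ} {f g : Finset V → k} (hf : f ∈ cochains K k (p + 1))
    (hg : g ∈ cochains K k q) :
    coboundary K k (cup K k f g) =
      cup K k (coboundary K k f) g + (-1 : k) ^ p • cup K k f (coboundary K k g) := by
  ext s
  rw [Pi.add_apply, Pi.smul_apply, smul_eq_mul]
  by_cases hs : s ∈ K
  swap
  · rw [coboundary_of_notMem hs, cup_of_notMem hs, cup_of_notMem hs]
    simp
  rw [coboundary_apply hs, cup_apply hs, cup_apply hs]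
  have hL : ∑ v ∈ s, (-1 : k) ^ (s.filter (· < v)).card * cup K k f g (s.erase v) =
      ∑ w ∈ s, ∑ v ∈ s.erase w, (-1 : k) ^ (s.filter (· < v)).card *
        (f ((s.erase v).filter (· ≤ w)) * g ((s.erase v).filter (w ≤ ·))) := by
    rw [Finset.sum_congr rfl fun v _ => by rw [cup_erase hs v, Finset.mul_sum]]
    refine Finset.sum_comm' fun x y => ?_
    simp only [Finset.mem_erase]
    tauto
  have hT := telescope (fun t => f t * g (s \ t)) s
  simp only [Finset.sdiff_self, Finset.sdiff_empty, cochains_empty hf, cochains_empty hg,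
    zero_mul, mul_zero, sub_zero] at hT
  rw [hL, ← sub_eq_zero, ← neg_eq_zero, ← hT, ← sub_eq_zero, Finset.mul_sum, neg_sub,
    ← Finset.sum_add_distrib, ← Finset.sum_sub_distrib, ← Finset.sum_sub_distrib]
  refine Finset.sum_eq_zero fun w hw => ?_
  rw [coboundary_apply (filter_le_mem hs hw), coboundary_apply (filter_ge_mem hs hw),
    sum_filter_le_split _ hw, sum_filter_ge_split _ hw, sum_erase_split]
  have a1 : ∀ v ∈ s.filter (· < w), (s.erase v).filter (· ≤ w) = (s.filter (· ≤ w)).erase v :=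
    fun v _ => Finset.filter_erase _ _ _
  have a2 : ∀ v ∈ s.filter (· < w), (s.erase v).filter (w ≤ ·) = s.filter (w ≤ ·) :=
    fun v hv => by
      rw [Finset.filter_erase, Finset.erase_eq_of_notMem]
      simp only [Finset.mem_filter, not_and, not_le] at hv ⊢
      exact fun _ => hv.2
  have a3 : ∀ v ∈ s.filter (w < ·), (s.erase v).filter (· ≤ w) = s.filter (· ≤ w) :=
    fun v hv => by
      rw [Finset.filter_erase, Finset.erase_eq_of_notMem]
      simp only [Finset.mem_filter, not_and, not_le] at hv ⊢
      exact fun _ => hv.2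
  have a4 : ∀ v ∈ s.filter (w < ·), (s.erase v).filter (w ≤ ·) = (s.filter (w ≤ ·)).erase v :=
    fun v _ => Finset.filter_erase _ _ _
  have a5 : ∀ v, v ≤ w → (s.filter (· ≤ w)).filter (· < v) = s.filter (· < v) := fun v hv => by
    ext x
    simp only [Finset.mem_filter]
    exact ⟨fun h => ⟨h.1.1, h.2⟩, fun h => ⟨⟨h.1, h.2.le.trans hv⟩, h.2⟩⟩
  have a6 : (s.filter (· ≤ w)).erase w = s.filter (· < w) := by
    ext x
    simp only [Finset.mem_filter, Finset.mem_erase, lt_iff_le_and_ne]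
    tauto
  have a7 : (s.filter (w ≤ ·)).erase w = s \ s.filter (· ≤ w) := by
    ext x
    simp only [Finset.mem_filter, Finset.mem_erase, Finset.mem_sdiff, not_and, not_le]
    constructor
    · rintro ⟨h1, h2, h3⟩
      exact ⟨h2, fun _ => lt_of_le_of_ne h3 (Ne.symm h1)⟩
    · rintro ⟨h1, h2⟩
      exact ⟨(h2 h1).ne', h1, (h2 h1).le⟩
  have a8 : s \ s.filter (· < w) = s.filter (w ≤ ·) := by
    ext x
    simp only [Finset.mem_filter, Finset.mem_sdiff, not_and, not_lt]
    tauto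
  have a9 : (s.filter (w ≤ ·)).filter (· < w) = ∅ := by
    ext x
    simp
  have sgn : ∀ v, w ≤ v → (-1 : k) ^ p * (f (s.filter (· ≤ w)) *
      ((-1) ^ ((s.filter (w ≤ ·)).filter (· < v)).card)) =
      (-1) ^ (s.filter (· < v)).card * f (s.filter (· ≤ w)) := fun v hv => by
    by_cases h0 : f (s.filter (· ≤ w)) = 0
    · simp [h0]
    · have hc := (hf _ h0).2
      have hc' : (s.filter (· < w)).card = p := by
        rw [← a6, Finset.card_erase_of_mem (by simp [hw]), hc, Nat.add_sub_cancel]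
      have hd : (s.filter (· < v)).card =
          (s.filter (· < w)).card + ((s.filter (w ≤ ·)).filter (· < v)).card := by
        rw [← Finset.card_union_of_disjoint]
        · congr 1
          ext x
          simp only [Finset.mem_filter, Finset.mem_union]
          constructor
          · intro h
            rcases lt_or_ge x w with h' | h'
            · exact Or.inl ⟨h.1, h'⟩
            · exact Or.inr ⟨⟨h.1, h'⟩, h.2⟩
          · rintro (h | h)
            · exact ⟨h.1, h.2.trans_le hv⟩
            · exact ⟨h.1.1, h.2⟩
        · rw [Finset.disjoint_left]
          intro x hx hx'
          simp only [Finset.mem_filter] at hx hx'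
          exact absurd hx.2 hx'.1.2.not_gt
      rw [hd, hc', pow_add]
      ring
  have b1 : ∑ v ∈ s.filter (· < w), (-1 : k) ^ (s.filter (· < v)).card *
      (f ((s.erase v).filter (· ≤ w)) * g ((s.erase v).filter (w ≤ ·))) =
      (∑ v ∈ s.filter (· < w), (-1 : k) ^ ((s.filter (· ≤ w)).filter (· < v)).card *
        f ((s.filter (· ≤ w)).erase v)) * g (s.filter (w ≤ ·)) := by
    rw [Finset.sum_mul]
    refine Finset.sum_congr rfl fun v hv => ?_
    rw [a1 v hv, a2 v hv, a5 v (Finset.mem_filter.mp hv).2.le]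
    ring
  have b2 : ∑ v ∈ s.filter (w < ·), (-1 : k) ^ (s.filter (· < v)).card *
      (f ((s.erase v).filter (· ≤ w)) * g ((s.erase v).filter (w ≤ ·))) =
      (-1) ^ p * (f (s.filter (· ≤ w)) *
        ∑ v ∈ s.filter (w < ·), (-1 : k) ^ ((s.filter (w ≤ ·)).filter (· < v)).card *
          g ((s.filter (w ≤ ·)).erase v)) := by
    rw [Finset.mul_sum, Finset.mul_sum]
    refine Finset.sum_congr rfl fun v hv => ?_
    rw [a3 v hv, a4 v hv]
    linear_combination (-g ((s.filter (w ≤ ·)).erase v)) * sgn v (Finset.mem_filter.mp hv).2.le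
  rw [b1, b2, a5 w le_rfl, a6, a7, a8]
  linear_combination g (s \ s.filter (· ≤ w)) * sgn w le_rfl

theorem cup_mem_cocycles {p q : ℕ} {f g : Finset V → k} (hf : f ∈ cocycles K k p)
    (hg : g ∈ cocycles K k q) : cup K k f g ∈ cocycles K k (p + q) := by
  refine ⟨cup_mem_cochains hf.1 hg.1 (by omega), LinearMap.mem_ker.mpr ?_⟩
  rw [coboundary_cup hf.1 hg.1, LinearMap.mem_ker.mp hf.2,
    LinearMap.mem_ker.mp hg.2]
  simp

theorem cup_coboundary_mem {p q : ℕ} {f g : Finset V → k} (hf : f ∈ cocycles K k p)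
    (hg : g ∈ coboundaries K k q) : cup K k f g ∈ coboundaries K k (p + q) := by
  obtain ⟨h, hh, rfl⟩ := hg
  refine ⟨(-1 : k) ^ p • cup K k f h,
    Submodule.smul_mem _ _ (cup_mem_cochains hf.1 hh (by omega)), ?_⟩
  rw [map_smul, coboundary_cup hf.1 hh, LinearMap.mem_ker.mp hf.2]
  simp [smul_smul, ← mul_pow]

theorem coboundary_cup_mem {p q : ℕ} {f g : Finset V → k} (hf : f ∈ coboundaries K k p)
    (hg : g ∈ cocycles K k q) : cup K k f g ∈ coboundaries K k (p + q) := by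
  obtain ⟨h, hh, rfl⟩ := hf
  cases p with
  | zero =>
    have h0 : h = 0 := by
      ext s
      by_contra hs
      obtain ⟨h1, h2⟩ := hh s hs
      rw [Finset.card_eq_zero] at h2
      exact (K.isRelLowerSet_faces h1).1.ne_empty h2
    rw [h0]
    simp
  | succ p =>
    refine ⟨cup K k h g, cup_mem_cochains hh hg.1 (by omega), ?_⟩
    rw [coboundary_cup hh hg.1, LinearMap.mem_ker.mp hg.2]
    simp

theorem unit_mem_cocycles : unit K k ∈ cocycles K k 0 := by
  refine ⟨fun s hs => ?_, LinearMap.mem_ker.mpr ?_⟩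
  · by_contra h
    exact hs (if_neg h)
  · ext s
    by_cases hs : s ∈ K
    swap
    · exact coboundary_of_notMem hs
    rw [coboundary_apply hs, Pi.zero_apply]
    by_cases h2 : s.card = 2
    · obtain ⟨x, y, hxy, rfl⟩ : ∃ x y, x < y ∧ s = {x, y} := by
        obtain ⟨x, y, hne, rfl⟩ := Finset.card_eq_two.mp h2
        rcases lt_or_gt_of_ne hne with h | h
        · exact ⟨x, y, h, rfl⟩
        · exact ⟨y, x, h, Finset.pair_comm _ _⟩
      have hx : ({x} : Finset V) ∈ K := mem_of_subset hs (by simp) (by simp)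
      have hy : ({y} : Finset V) ∈ K := mem_of_subset hs (by simp) (by simp)
      have e1 : ({x, y} : Finset V).erase x = {y} := by
        ext z
        simp only [Finset.mem_erase, Finset.mem_insert, Finset.mem_singleton]
        constructor
        · tauto
        · rintro rfl
          exact ⟨hxy.ne', Or.inr rfl⟩
      have e2 : ({x, y} : Finset V).erase y = {x} := by
        ext z
        simp only [Finset.mem_erase, Finset.mem_insert, Finset.mem_singleton]
        constructor
        · tauto
        · rintro rfl
          exact ⟨hxy.ne, Or.inl rfl⟩
      rw [Finset.sum_pair hxy.ne, e1, e2]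
      simp [unit, hx, hy, Finset.filter_insert, Finset.filter_singleton, hxy, hxy.not_gt]
    · refine Finset.sum_eq_zero fun v hv => ?_
      rw [unit, if_neg, mul_zero]
      rintro ⟨_, h⟩
      rw [Finset.card_erase_of_mem hv] at h
      omega

theorem unit_cup {m : ℕ} {f : Finset V → k} (hf : f ∈ cochains K k m) :
    cup K k (unit K k) f = f := by
  ext s
  by_cases hs : s ∈ K
  swap
  · rw [cup_of_notMem hs]
    by_contra h
    exact hs (hf s (Ne.symm h)).1
  have hne := (K.isRelLowerSet_faces hs).1
  have hmin := s.min'_mem hne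
  rw [cup_apply hs, Finset.sum_eq_single_of_mem _ hmin]
  · have e1 : s.filter (· ≤ s.min' hne) = {s.min' hne} := by
      ext x
      simp only [Finset.mem_filter, Finset.mem_singleton]
      constructor
      · exact fun h => le_antisymm h.2 (s.min'_le x h.1)
      · rintro rfl
        exact ⟨hmin, le_rfl⟩
    have e2 : s.filter (s.min' hne ≤ ·) = s :=
      Finset.filter_true_of_mem fun x hx => s.min'_le x hx
    have h1 : ({s.min' hne} : Finset V) ∈ K := e1 ▸ filter_le_mem hs hmin
    rw [e1, e2, unit, if_pos ⟨h1, Finset.card_singleton _⟩, one_mul]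
  · intro v hv hvm
    rw [unit, if_neg, zero_mul]
    rintro ⟨_, h⟩
    rw [Finset.card_eq_one] at h
    obtain ⟨x, hx⟩ := h
    have h1 : v ∈ s.filter (· ≤ v) := by simp [hv]
    have h2 : s.min' hne ∈ s.filter (· ≤ v) := by simp [hmin, s.min'_le v hv]
    rw [hx, Finset.mem_singleton] at h1 h2
    exact hvm (h1.trans h2.symm)

theorem cup_unit {m : ℕ} {f : Finset V → k} (hf : f ∈ cochains K k m) :
    cup K k f (unit K k) = f := by
  ext s
  by_cases hs : s ∈ K
  swap
  · rw [cup_of_notMem hs]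
    by_contra h
    exact hs (hf s (Ne.symm h)).1
  have hne := (K.isRelLowerSet_faces hs).1
  have hmax := s.max'_mem hne
  rw [cup_apply hs, Finset.sum_eq_single_of_mem _ hmax]
  · have e1 : s.filter (s.max' hne ≤ ·) = {s.max' hne} := by
      ext x
      simp only [Finset.mem_filter, Finset.mem_singleton]
      constructor
      · exact fun h => le_antisymm (s.le_max' x h.1) h.2
      · rintro rfl
        exact ⟨hmax, le_rfl⟩
    have e2 : s.filter (· ≤ s.max' hne) = s :=
      Finset.filter_true_of_mem fun x hx => s.le_max' x hx
    have h1 : ({s.max' hne} : Finset V) ∈ K := e1 ▸ filter_ge_mem hs hmax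
    rw [e1, e2, unit, if_pos ⟨h1, Finset.card_singleton _⟩, mul_one]
  · intro v hv hvm
    rw [unit, if_neg, mul_zero]
    rintro ⟨_, h⟩
    rw [Finset.card_eq_one] at h
    obtain ⟨x, hx⟩ := h
    have h1 : v ∈ s.filter (v ≤ ·) := by simp [hv]
    have h2 : s.max' hne ∈ s.filter (v ≤ ·) := by simp [hmax, s.le_max' v hv]
    rw [hx, Finset.mem_singleton] at h1 h2
    exact hvm (h1.trans h2.symm)

theorem cup_assoc (f g h : Finset V → k) :
    cup K k (cup K k f g) h = cup K k f (cup K k g h) := by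
  ext s
  by_cases hs : s ∈ K
  swap
  · rw [cup_of_notMem hs, cup_of_notMem hs]
  rw [cup_apply hs, cup_apply hs]
  rw [Finset.sum_congr rfl fun w hw => by rw [cup_apply (filter_le_mem hs hw), Finset.sum_mul]]
  symm
  rw [Finset.sum_congr rfl fun v hv => by rw [cup_apply (filter_ge_mem hs hv), Finset.mul_sum]]
  symm
  rw [Finset.sum_comm' (s' := fun v => s.filter (v ≤ ·)) (t' := s)
    (by intro x y; simp only [Finset.mem_filter]; tauto)]
  refine Finset.sum_congr rfl fun v hv => Finset.sum_congr rfl fun w hw => ?_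
  have hvw := (Finset.mem_filter.mp hw).2
  have e1 : (s.filter (· ≤ w)).filter (· ≤ v) = s.filter (· ≤ v) := by
    ext x
    simp only [Finset.mem_filter]
    exact ⟨fun h => ⟨h.1.1, h.2⟩, fun h => ⟨⟨h.1, h.2.trans hvw⟩, h.2⟩⟩
  have e2 : (s.filter (v ≤ ·)).filter (w ≤ ·) = s.filter (w ≤ ·) := by
    ext x
    simp only [Finset.mem_filter]
    exact ⟨fun h => ⟨h.1.1, h.2⟩, fun h => ⟨⟨h.1, hvw.trans h.2⟩, h.2⟩⟩
  have e3 : (s.filter (· ≤ w)).filter (v ≤ ·) = (s.filter (v ≤ ·)).filter (· ≤ w) :=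
    Finset.filter_comm _ _ _
  rw [e1, e2, e3, mul_assoc]

end SimplicialCohomology

namespace SimplicialH

open SimplicialCohomology

variable {V : Type*} [LinearOrder V] (K : PreAbstractSimplicialComplex V) (k : Type u) [Field k]

instance (n : ℕ) : AddCommGroup (SimplicialH K k n) :=
  inferInstanceAs (AddCommGroup (cocycles K k n ⧸ _))

instance (n : ℕ) : Module k (SimplicialH K k n) :=
  inferInstanceAs (Module k (cocycles K k n ⧸ _))

/-- The cohomology class of a cocycle. -/
def mk (n : ℕ) : cocycles K k n →ₗ[k] SimplicialH K k n :=
  ((coboundaries K k n).submoduleOf (cocycles K k n)).mkQ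

/-- The class of the cup product of two cocycles. -/
def mkCup (p q : ℕ) : cocycles K k p →ₗ[k] cocycles K k q →ₗ[k] SimplicialH K k (p + q) :=
  LinearMap.mk₂ k (fun f g => mk K k (p + q) ⟨cup K k f g, cup_mem_cocycles f.2 g.2⟩)
    (fun f f' g => by rw [← map_add]; congr 1; ext1; simp)
    (fun c f g => by rw [← map_smul]; congr 1; ext1; simp)
    (fun f g g' => by rw [← map_add]; congr 1; ext1; simp)
    (fun c f g => by rw [← map_smul]; congr 1; ext1; simp)

/-- The cup product in cohomology. -/
def mul (p q : ℕ) :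
    SimplicialH K k p →ₗ[k] SimplicialH K k q →ₗ[k] SimplicialH K k (p + q) :=
  Submodule.liftQ _ (LinearMap.flip (Submodule.liftQ _ (mkCup K k p q).flip fun _ hg =>
    LinearMap.mem_ker.mpr (LinearMap.ext fun f =>
      (Submodule.Quotient.mk_eq_zero _).mpr (cup_coboundary_mem f.2 hg)))) fun _ hf =>
    LinearMap.mem_ker.mpr (LinearMap.ext fun b =>
      Submodule.Quotient.induction_on _ b fun g =>
        (Submodule.Quotient.mk_eq_zero _).mpr (coboundary_cup_mem hf g.2))

variable {K k} in
theorem mul_mk {p q : ℕ} (f : cocycles K k p) (g : cocycles K k q) :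
    mul K k p q (mk K k p f) (mk K k q g) =
      mk K k (p + q) ⟨cup K k f g, cup_mem_cocycles f.2 g.2⟩ := rfl

variable {K k} in
theorem mk_surjective {n : ℕ} (a : SimplicialH K k n) : ∃ f, mk K k n f = a :=
  Submodule.mkQ_surjective _ a

variable {K k} in
theorem graded_mk_eq {m n : ℕ} (h : m = n) (f : cocycles K k m) (g : cocycles K k n)
    (hfg : (f : Finset V → k) = g) :
    GradedMonoid.mk (A := SimplicialH K k) m (mk K k m f) =
      GradedMonoid.mk (A := SimplicialH K k) n (mk K k n g) := by
  subst h
  rw [Subtype.ext hfg]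

instance : GradedMonoid.GOne (SimplicialH K k) where
  one := mk K k 0 ⟨unit K k, unit_mem_cocycles⟩

instance : GradedMonoid.GMul (SimplicialH K k) where
  mul {p q} a b := mul K k p q a b

instance : GradedMonoid.GMonoid (SimplicialH K k) where
  one_mul := by
    rintro ⟨n, a⟩
    obtain ⟨f, rfl⟩ := mk_surjective a
    exact graded_mk_eq (zero_add n) _ _ (unit_cup f.2.1)
  mul_one := by
    rintro ⟨n, a⟩
    obtain ⟨f, rfl⟩ := mk_surjective a
    exact graded_mk_eq (add_zero n) _ _ (cup_unit f.2.1)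
  mul_assoc := by
    rintro ⟨p, a⟩ ⟨q, b⟩ ⟨r, c⟩
    obtain ⟨f, rfl⟩ := mk_surjective a
    obtain ⟨g, rfl⟩ := mk_surjective b
    obtain ⟨h, rfl⟩ := mk_surjective c
    exact graded_mk_eq (add_assoc p q r) _ _ (cup_assoc _ _ _)

instance : DirectSum.GRing (SimplicialH K k) where
  mul_zero a := map_zero (mul K k _ _ a)
  zero_mul b := LinearMap.map_zero₂ (mul K k _ _) b
  mul_add a b c := map_add (mul K k _ _ a) b c
  add_mul a b c := LinearMap.map_add₂ (mul K k _ _) a b c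
  natCast n := n • GradedMonoid.GOne.one
  natCast_zero := zero_smul _ _
  natCast_succ n := succ_nsmul _ n
  intCast n := n • GradedMonoid.GOne.one
  intCast_ofNat n := natCast_zsmul _ n
  intCast_negSucc_ofNat n := negSucc_zsmul _ n

instance : DirectSum.GAlgebra k (SimplicialH K k) where
  toFun :=
    { toFun := fun r => r • GradedMonoid.GOne.one
      map_zero' := zero_smul _ _
      map_add' := fun r s => add_smul r s _ }
  map_one := one_smul _ _
  map_mul r s := by
    let e : cocycles K k 0 := ⟨unit K k, unit_mem_cocycles⟩
    refine graded_mk_eq (zero_add 0).symm ((r * s) • e)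
      ⟨cup K k (r • e) (s • e), cup_mem_cocycles (r • e).2 (s • e).2⟩ ?_
    simp [e, unit_cup (unit_mem_cocycles (K := K) (k := k)).1, smul_smul, mul_comm]
  commutes := by
    rintro r ⟨n, a⟩
    obtain ⟨f, rfl⟩ := mk_surjective a
    let e : cocycles K k 0 := ⟨unit K k, unit_mem_cocycles⟩
    refine graded_mk_eq ((zero_add n).trans (add_zero n).symm)
      ⟨cup K k (r • e) f, cup_mem_cocycles (r • e).2 f.2⟩
      ⟨cup K k f (r • e), cup_mem_cocycles f.2 (r • e).2⟩ ?_
    simp [e, unit_cup f.2.1, cup_unit f.2.1]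
  smul_def := by
    rintro r ⟨n, a⟩
    obtain ⟨f, rfl⟩ := mk_surjective a
    let e : cocycles K k 0 := ⟨unit K k, unit_mem_cocycles⟩
    refine graded_mk_eq (zero_add n).symm (r • f)
      ⟨cup K k (r • e) f, cup_mem_cocycles (r • e).2 f.2⟩ ?_
    simp [e, unit_cup f.2.1]

end SimplicialH

/-! ### The sphere -/

/-- The geometric realization of a simplicial complex with finitely many vertices, in barycentric
coordinates. -/
def geometricRealization {V : Type*} [Fintype V] (K : PreAbstractSimplicialComplex V) :
    Set (V → ℝ) :=
  {x | x ∈ stdSimplex ℝ V ∧ (Finset.univ.filter fun v => x v ≠ 0) ∈ K}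

/-- The boundary of the tetrahedron with vertices `0, 1, 2, 3`, a triangulation of the sphere. -/
def sphereComplex : PreAbstractSimplicialComplex (Fin 4) where
  faces := {s | s.Nonempty ∧ s ≠ Finset.univ}
  isRelLowerSet_faces := fun {_} hs => ⟨hs.1, fun _ hts ht =>
    ⟨ht, fun h => hs.2 (Finset.univ_subset_iff.mp (h ▸ hts))⟩⟩

/-- The cohomology algebra `H^*(S²; k)`, with the cup product. -/
abbrev SphereCohomology (k : Type u) [Field k] : Type u := ⨁ n : ℕ, SimplicialH sphereComplex k n

open SimplicialCohomology in
/-- The value of a cochain on the fundamental cycle `∑ i, (-1)^i [0, …, î, …, 3]` of the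
tetrahedron's boundary. -/
def evalFundamental (k : Type u) [Field k] : (Finset (Fin 4) → k) →ₗ[k] k where
  toFun f := ∑ i : Fin 4, (-1) ^ (i : ℕ) * f (Finset.univ.erase i)
  map_add' f g := by simp [mul_add, Finset.sum_add_distrib]
  map_smul' c f := by simp [Finset.mul_sum, mul_left_comm]

open SimplicialCohomology in
theorem evalFundamental_coboundary {k : Type u} [Field k] (f : Finset (Fin 4) → k) :
    evalFundamental k (coboundary sphereComplex k f) = 0 := by
  have h : ∀ i : Fin 4, (Finset.univ.erase i : Finset (Fin 4)) ∈ sphereComplex := by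
    intro i
    refine ⟨?_, ?_⟩ <;> revert i <;> decide
  have h0 : (Finset.univ.erase 0 : Finset (Fin 4)) = {1, 2, 3} := by decide
  have h1 : (Finset.univ.erase 1 : Finset (Fin 4)) = {0, 2, 3} := by decide
  have h2 : (Finset.univ.erase 2 : Finset (Fin 4)) = {0, 1, 3} := by decide
  have h3 : (Finset.univ.erase 3 : Finset (Fin 4)) = {0, 1, 2} := by decide
  simp only [evalFundamental, LinearMap.coe_mk, AddHom.coe_mk]
  rw [Finset.sum_congr rfl fun i _ => by rw [coboundary_apply (h i)], Fin.sum_univ_four,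
    h0, h1, h2, h3]
  have e1 : ({1, 2, 3} : Finset (Fin 4)).erase 2 = {1, 3} := by decide
  have e2 : ({1, 2, 3} : Finset (Fin 4)).erase 3 = {1, 2} := by decide
  have e3 : ({0, 2, 3} : Finset (Fin 4)).erase 2 = {0, 3} := by decide
  have e4 : ({0, 2, 3} : Finset (Fin 4)).erase 3 = {0, 2} := by decide
  have e5 : ({0, 1, 3} : Finset (Fin 4)).erase 1 = {0, 3} := by decide
  have e6 : ({0, 1, 3} : Finset (Fin 4)).erase 3 = {0, 1} := by decide
  have e7 : ({0, 1, 2} : Finset (Fin 4)).erase 1 = {0, 2} := by decide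
  have e8 : ({0, 1, 2} : Finset (Fin 4)).erase 2 = {0, 1} := by decide
  simp [Finset.sum_insert, Finset.filter_insert, Finset.filter_singleton,
    e1, e2, e3, e4, e5, e6, e7, e8]
  ring

/-- The Poincaré trace on `H^*(S²; k)`: the evaluation on the fundamental class in degree `2`, and
zero in all other degrees. -/
def poincareTrace (k : Type u) [Field k] : SphereCohomology k →ₗ[k] k :=
  Submodule.liftQ _ (evalFundamental k ∘ₗ (SimplicialCohomology.cocycles sphereComplex k 2).subtype)
    (by
      rintro f ⟨g, _, hg⟩
      exact LinearMap.mem_ker.mpr ((congrArg (evalFundamental k) hg).symm.trans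
        (evalFundamental_coboundary g))) ∘ₗ
    DirectSum.component k ℕ (SimplicialH sphereComplex k) 2

end

/-! Write `a` and `b` for the two crossings of the black strand with the right red strand. A black
strand that crosses the left red strand runs through a slice starting with black, so the bigon
relation kills the dot on red, black, red, that is `b * a = 0`. Hence `T20 k` has the basis `e₁, e₂,
a, b, a * b`: it is the path algebra of a quiver with two vertices and arrows `a`, `b`, modulo `b *
a` (`comb_surjective`, `comb_injective`). Independence comes from its faithful action on `P₂`.

The radical `J` of `P₁` is the line spanned by `a`, and it is the other simple module. Right
multiplication by `b` and `a` gives a projective resolution `0 → P₁ → P₂ → P₁ → L₁ → 0`. Since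
`Hom(P₂, L₁) = 0` and `Hom(P₁, L₁) = k`, the space `Ext^n(L₁, L₁)` is a line for `n = 0, 2` and zero
otherwise (`isSphericalResolution`).

For the duality, choose an isomorphism `Ext²(L₁, L₁) ≅ k` and compose it with the Yoneda product.
The resulting pairing of `Ext^i(L₁, M)` with `Ext^(2-i)(M, L₁)` is natural by associativity. It is
perfect for the two simple modules by direct computation (`isDual_L`, `isDual_K`), and a five lemma
argument carries perfection through extensions (`IsDual.of_shortExact`). Finitely generated modules
have finite length, so they are all covered.

For an arbitrary duality, the counit is bijective on `Ext²(L₁, L₁)`, because the identity spans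
`Ext⁰(L₁, L₁)`. A graded algebra of this size is the algebra of dual numbers, with a generator in
degree 2 on which the counit can be normalised to 1 (`exists_dualNumber_algEquiv`). The same holds
for `H^*(S²)` with evaluation on the fundamental class, so both Frobenius algebras are identified
with the dual numbers. -/

noncomputable section

/-! ### Pairings of Ext-spaces -/

namespace CategoryTheory.Abelian.Ext

universe w v v' t

variable {k : Type t} [Field k] {C : Type v} [Category.{v'} C] [Abelian C] [Linear k C]
  [HasExt.{w} C] {L : C}

/-- The pairing of `Ext^i(L, M)` with `Ext^j(M, L)` that a linear form on `Ext^n(L, L)`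
induces. -/
def pairing {n : ℕ} (ε : Ext L L n →ₗ[k] k) (M : C) {i j : ℕ} (h : i + j = n) :
    Ext L M i →ₗ[k] Module.Dual k (Ext M L j) :=
  (LinearMap.compRight k ε) ∘ₗ bilinearCompOfLinear k L M L i j n h

@[simp]
theorem pairing_apply {n : ℕ} (ε : Ext L L n →ₗ[k] k) (M : C) {i j : ℕ} (h : i + j = n)
    (a : Ext L M i) (b : Ext M L j) : pairing ε M h a b = ε (a.comp b h) := rfl

/-- The object `M` satisfies duality of dimension `n` with respect to `L` and a linear form on
`Ext^n(L, L)`. -/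
structure IsDual {n : ℕ} (ε : Ext L L n →ₗ[k] k) (M : C) : Prop where
  bijective {i j : ℕ} (h : i + j = n) : Function.Bijective (pairing ε M h)
  vanish (j : ℕ) (hj : n < j) : Subsingleton (Ext M L j)

variable {n : ℕ} {ε : Ext L L n →ₗ[k] k}

/-- Associativity of the Yoneda product. It gives the naturality in `ExtDuality`, and it makes the
squares commute in the diagram chases below. -/
theorem pairing_comp {M N : C} {i p j i' j' : ℕ} (hi : i + p = i') (hj : p + j = j')
    (h : i + j' = n) (h' : i' + j = n) (a : Ext L M i) (f : Ext M N p) (b : Ext N L j) :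
    pairing ε N h' (a.comp f hi) b = pairing ε M h a (f.comp b hj) := by
  simp only [pairing_apply]
  rw [comp_assoc _ _ _ hi hj (by omega)]

theorem IsDual.of_isZero {M : C} (hM : Limits.IsZero M) : IsDual ε M := by
  have h₁ : ∀ i, Subsingleton (Ext L M i) := fun i => subsingleton_of_forall_eq 0 fun x => by
    rw [← comp_mk₀_id x, hM.eq_of_src (𝟙 M) 0, mk₀_zero, comp_zero]
  have h₂ : ∀ i, Subsingleton (Ext M L i) := fun i => subsingleton_of_forall_eq 0 fun x => by
    rw [← mk₀_id_comp x, hM.eq_of_src (𝟙 M) 0, mk₀_zero, zero_comp]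
  refine ⟨fun {i j} h => ⟨fun x y _ => (h₁ i).elim x y, fun f => ⟨0, ?_⟩⟩, fun j _ => h₂ j⟩
  ext x
  rw [(h₂ j).elim x 0, map_zero, map_zero]

/-- A linear form that vanishes on the kernel of a linear map factors through it. -/
theorem exists_comp_eq_of_ker_le {V W : Type*} [AddCommGroup V] [Module k V]
    [AddCommGroup W] [Module k W] (f : V →ₗ[k] W) (φ : Module.Dual k V)
    (h : ∀ x, f x = 0 → φ x = 0) : ∃ ψ : Module.Dual k W, ∀ x, ψ (f x) = φ x := by
  have : φ ∈ (LinearMap.ker f).dualAnnihilator := by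
    rw [Submodule.mem_dualAnnihilator]
    exact fun x hx => h x hx
  rw [← LinearMap.range_dualMap_eq_dualAnnihilator_ker] at this
  obtain ⟨ψ, rfl⟩ := this
  exact ⟨ψ, fun _ => rfl⟩

/-! ### Duality passes through extensions -/

variable {S : ShortComplex C} (hS : S.ShortExact)
include hS

/-- One half of the five lemma. A class `a` in the kernel dies in `Ext(L, X₃)`, so it comes from
some `a'` over `X₁`. The form `⟨a', -⟩` vanishes on restrictions from `X₂`, hence factors through
the connecting map as a form `ψ` on `Ext^(j+1)(X₃, L)`. Duality for `X₃` represents `ψ`, so `a'` is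
itself a connecting image and maps to zero. -/
theorem pairing_injective_of_shortExact (h₁ : IsDual ε S.X₁) (h₃ : IsDual ε S.X₃) {i j : ℕ}
    (h : i + j = n) : Function.Injective (pairing ε S.X₂ h) := by
  rw [injective_iff_map_eq_zero]
  intro a ha
  obtain ⟨a', rfl⟩ := covariant_sequence_exact₂ L hS a <| (h₃.bijective h).1 <| by
    ext b
    rw [pairing_comp (add_zero i) (zero_add j) h h, ha]
    simp
  have hf : ∀ b : Ext S.X₂ L j, pairing ε S.X₁ h a' ((mk₀ S.f).comp b (zero_add j)) = 0 :=
    fun b => by rw [← pairing_comp (add_zero i) (zero_add j) h h, ha]; rfl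
  have hδ : ∀ x, precompOfLinear hS.extClass k L (add_comm 1 j) x = 0 →
      pairing ε S.X₁ h a' x = 0 := by
    intro x hx
    obtain ⟨y, rfl⟩ := contravariant_sequence_exact₁ hS L x (add_comm 1 j) hx
    exact hf y
  obtain ⟨ψ, hψ⟩ := exists_comp_eq_of_ker_le _ _ hδ
  rcases Nat.eq_zero_or_pos i with rfl | hi
  -- For `i = 0` there is no `Ext^(i-1)(L, X₃)` to represent `ψ`, but then `j + 1 > n` and the space
  -- carrying `ψ` is zero.
  · have := h₃.vanish (j + 1) (by omega)
    suffices a' = 0 by rw [this, zero_comp]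
    refine (h₁.bijective h).1 (LinearMap.ext fun x => ?_)
    rw [← hψ, Subsingleton.elim (precompOfLinear hS.extClass k L (add_comm 1 j) x) 0]
    simp
  · obtain ⟨i, rfl⟩ := Nat.exists_eq_add_of_lt hi
    obtain ⟨a'', ha''⟩ := (h₃.bijective (i := i) (j := j + 1) (by omega)).2 ψ
    have : a' = a''.comp hS.extClass (by omega) := by
      refine (h₁.bijective h).1 (LinearMap.ext fun x => ?_)
      rw [pairing_comp (h := by omega) (hj := add_comm 1 j), ha'', ← hψ]
      rfl
    rw [this, comp_assoc_of_third_deg_zero, ShortComplex.ShortExact.extClass_comp, comp_zero]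

/-- The other half. The pullback of `φ` to `Ext^j(X₃, L)` is represented by some `c`, which lifts to
`a` over `X₂` once its connecting image is zero. The error `φ - ⟨a, -⟩` then factors through
`Ext^j(X₁, L)`, where it is represented by `d`, and `d` corrects `a`. -/
theorem pairing_surjective_of_shortExact (h₁ : IsDual ε S.X₁) (h₃ : IsDual ε S.X₃) {i j : ℕ}
    (h : i + j = n) (hL : Subsingleton (Ext L S.X₁ (n + 1))) :
    Function.Surjective (pairing ε S.X₂ h) := by
  intro φ
  obtain ⟨c, hc⟩ := (h₃.bijective h).2 (φ ∘ₗ precompOfLinear (mk₀ S.g) k L (zero_add j))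
  have hc' : c.comp hS.extClass rfl = 0 := by
    rcases Nat.eq_zero_or_pos j with rfl | hj
    · obtain rfl : i = n := by omega
      exact Subsingleton.elim _ _
    · obtain ⟨j, rfl⟩ := Nat.exists_eq_add_of_lt hj
      refine (h₁.bijective (j := j) (by omega)).1 (LinearMap.ext fun x => ?_)
      rw [pairing_comp (h := h) (hj := by omega), hc]
      simp
  obtain ⟨a, rfl⟩ := covariant_sequence_exact₃ L hS c rfl hc'
  have hker : ∀ x, precompOfLinear (mk₀ S.f) k L (zero_add j) x = 0 →
      (φ - pairing ε S.X₂ h a) x = 0 := by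
    intro x hx
    obtain ⟨y, rfl⟩ := contravariant_sequence_exact₂ hS L x hx
    have := LinearMap.congr_fun hc y
    rw [pairing_comp (h := h) (hj := zero_add j)] at this
    rw [LinearMap.sub_apply, this]
    simp
  obtain ⟨ψ, hψ⟩ := exists_comp_eq_of_ker_le _ _ hker
  obtain ⟨d, rfl⟩ := (h₁.bijective h).2 ψ
  refine ⟨a + d.comp (mk₀ S.f) (add_zero i), LinearMap.ext fun x => ?_⟩
  have := hψ x
  rw [map_add, LinearMap.add_apply, pairing_comp (h := h) (hj := zero_add j)]
  simp only [LinearMap.sub_apply] at this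
  exact (congrArg _ this).trans (by abel)

theorem IsDual.of_shortExact (h₁ : IsDual ε S.X₁) (h₃ : IsDual ε S.X₃)
    (hL : Subsingleton (Ext L S.X₁ (n + 1))) : IsDual ε S.X₂ where
  bijective h := ⟨pairing_injective_of_shortExact hS h₁ h₃ h,
    pairing_surjective_of_shortExact hS h₁ h₃ h hL⟩
  vanish j hj := subsingleton_of_forall_eq 0 fun x => by
    have := h₁.vanish j hj
    have := h₃.vanish j hj
    obtain ⟨y, rfl⟩ := contravariant_sequence_exact₂ hS L x (Subsingleton.elim _ _)
    rw [Subsingleton.elim y 0, comp_zero]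

end CategoryTheory.Abelian.Ext

/-! ### Spherical objects -/

namespace CategoryTheory.Abelian.Ext

universe w v v' t

section DimensionShift

variable {C : Type v} [Category.{v'} C] [Abelian C] [HasExt.{w} C] {S : ShortComplex C}
  (hS : S.ShortExact) [Projective S.X₂] {Y : C}

theorem exists_extClass_comp_eq {n m : ℕ} (h : 1 + n = m) (x : Ext S.X₃ Y m) :
    ∃ y : Ext S.X₁ Y n, hS.extClass.comp y h = x := by
  obtain rfl : m = n + 1 := by omega
  exact contravariant_sequence_exact₃ hS Y x (eq_zero_of_projective _) h

/-- The kernel of the connecting map is the image of `Ext^(n+1)(X₂, Y)`, which has positive degree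
and so vanishes by projectivity. In degree zero this image is a quotient of `Hom(X₂, Y)`, which has
to vanish for another reason; hence the next lemma. -/
theorem extClass_comp_succ_eq_zero {n m : ℕ} (h : 1 + (n + 1) = m) {y : Ext S.X₁ Y (n + 1)}
    (hy : hS.extClass.comp y h = 0) : y = 0 := by
  obtain ⟨z, rfl⟩ := contravariant_sequence_exact₁ hS Y y h hy
  rw [eq_zero_of_projective z, comp_zero]

omit [Projective S.X₂] in
theorem extClass_comp_eq_zero_of_hom {m : ℕ} (h : 1 + 0 = m) (hY : ∀ f : S.X₂ ⟶ Y, f = 0)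
    {y : Ext S.X₁ Y 0} (hy : hS.extClass.comp y h = 0) : y = 0 := by
  obtain ⟨z, rfl⟩ := contravariant_sequence_exact₁ hS Y y h hy
  obtain ⟨f, rfl⟩ := homEquiv₀.symm.surjective z
  rw [hY f]
  simp

theorem subsingleton_zero_of_hom {X Y : C} (h : ∀ f : X ⟶ Y, f = 0) :
    Subsingleton (Ext X Y 0) := subsingleton_of_forall_eq 0 fun x => by
  obtain ⟨f, rfl⟩ := homEquiv₀.symm.surjective x
  rw [h f]
  simp

end DimensionShift

/-- A projective resolution `0 → P → Q → P → L` that is spliced from two short exact sequences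
`0 → K → P → L → 0` and `0 → P → Q → K → 0`, with the spaces of morphisms that make `L` a spherical
object. -/
structure IsSphericalResolution (k : Type t) [Field k] {C : Type v} [Category.{v'} C] [Abelian C]
    [Linear k C] {K P Q L : C} (ι : K ⟶ P) (π : P ⟶ L) (β : P ⟶ Q) (γ : Q ⟶ K) : Prop where
  ι_π : ι ≫ π = 0
  β_γ : β ≫ γ = 0
  shortExact_π : (ShortComplex.mk ι π ι_π).ShortExact
  shortExact_γ : (ShortComplex.mk β γ β_γ).ShortExact
  projective_P : Projective P
  projective_Q : Projective Q
  hom_P_K (f : P ⟶ K) : f = 0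
  hom_Q_L (f : Q ⟶ L) : f = 0
  hom_K_L (f : K ⟶ L) : f = 0
  hom_P_L (f : P ⟶ L) : ∃ c : k, f = c • π
  hom_K_K (f : K ⟶ K) : ∃ c : k, f = c • 𝟙 K
  π_ne_zero : π ≠ 0

/-! ### Ext-spaces between `K` and `L` -/

namespace IsSphericalResolution

variable {k : Type t} [Field k] {C : Type v} [Category.{v'} C] [Abelian C] [Linear k C]
  {K P Q L : C} {ι : K ⟶ P} {π : P ⟶ L} {β : P ⟶ Q} {γ : Q ⟶ K}
  (R : IsSphericalResolution k ι π β γ)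
include R

theorem epi_π : Epi π := R.shortExact_π.epi_g

theorem hom_L_K (f : L ⟶ K) : f = 0 := by
  have := R.epi_π
  rw [← cancel_epi π, Limits.comp_zero]
  exact R.hom_P_K _

theorem hom_L_L (f : L ⟶ L) : ∃ c : k, f = c • 𝟙 L := by
  have := R.epi_π
  obtain ⟨c, hc⟩ := R.hom_P_L (π ≫ f)
  exact ⟨c, by rw [← cancel_epi π, hc]; simp⟩

variable [HasExt.{w} C]

/-- The sequence `0 → P → Q → K → 0` bounds the projective dimension of `K` by 1; the next lemma
shifts this to the bound 2 for `L`. -/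
theorem subsingleton_of_one_lt (M : C) {i : ℕ} (hi : 1 < i) : Subsingleton (Ext K M i) := by
  have := R.projective_P
  have := R.projective_Q
  obtain ⟨i, rfl⟩ : ∃ j, i = j + 2 := ⟨i - 2, by omega⟩
  refine subsingleton_of_forall_eq 0 fun x => ?_
  obtain ⟨y, rfl⟩ := exists_extClass_comp_eq R.shortExact_γ (n := i + 1) (by omega) x
  rw [eq_zero_of_projective y, comp_zero]

theorem subsingleton_of_two_lt (M : C) {i : ℕ} (hi : 2 < i) : Subsingleton (Ext L M i) := by
  have := R.projective_P
  have := R.subsingleton_of_one_lt M (i := i - 1) (by omega)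
  refine subsingleton_of_forall_eq 0 fun x => ?_
  obtain ⟨y, rfl⟩ := exists_extClass_comp_eq R.shortExact_π (n := i - 1) (by omega) x
  rw [Subsingleton.elim y 0, comp_zero]

/-- This space is a quotient of `Hom(K, L) = 0`. In the same way `Ext^1(K, K)` is a quotient of
`Hom(P, K) = 0`, and `Ext^2(L, K)` one of `Ext^1(K, K)`. -/
theorem subsingleton_one : Subsingleton (Ext L L 1) := by
  have := R.projective_P
  have := subsingleton_zero_of_hom R.hom_K_L
  refine subsingleton_of_forall_eq 0 fun x => ?_
  obtain ⟨y, rfl⟩ := exists_extClass_comp_eq R.shortExact_π (n := 0) (by omega) x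
  rw [Subsingleton.elim y 0, comp_zero]

theorem subsingleton_K_one : Subsingleton (Ext K K 1) := by
  have := R.projective_Q
  have := subsingleton_zero_of_hom R.hom_P_K
  refine subsingleton_of_forall_eq 0 fun x => ?_
  obtain ⟨y, rfl⟩ := exists_extClass_comp_eq R.shortExact_γ (n := 0) (by omega) x
  rw [Subsingleton.elim y 0, comp_zero]

theorem subsingleton_two : Subsingleton (Ext L K 2) := by
  have := R.projective_P
  have := R.subsingleton_K_one
  refine subsingleton_of_forall_eq 0 fun x => ?_
  obtain ⟨y, rfl⟩ := exists_extClass_comp_eq R.shortExact_π (n := 1) (by omega) x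
  rw [Subsingleton.elim y 0, comp_zero]

theorem exists_smul_id_eq (x : Ext L L 0) : ∃ c : k, x = c • mk₀ (𝟙 L) := by
  obtain ⟨f, rfl⟩ := homEquiv₀.symm.surjective x
  obtain ⟨c, rfl⟩ := R.hom_L_L f
  exact ⟨c, mk₀_smul c _⟩

theorem exists_smul_eq_of_L_K (x : Ext L K 1) : ∃ c : k, x = c • R.shortExact_π.extClass := by
  have := R.projective_P
  obtain ⟨y, rfl⟩ := exists_extClass_comp_eq R.shortExact_π (n := 0) (by omega) x
  obtain ⟨f, rfl⟩ := homEquiv₀.symm.surjective y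
  obtain ⟨c, rfl⟩ := R.hom_K_K f
  refine ⟨c, ?_⟩
  have : homEquiv₀.symm (c • 𝟙 K) = c • mk₀ (𝟙 K) := mk₀_smul c _
  rw [this, comp_smul]
  exact congrArg _ (comp_mk₀_id _)

/-- The generator of `Ext^1(K, L)`. -/
def extKL : Ext K L 1 := R.shortExact_γ.extClass.comp (mk₀ π) rfl

/-- The generator of `Ext^2(L, L)`. -/
def extLL : Ext L L 2 := R.shortExact_π.extClass.comp R.extKL rfl

theorem exists_smul_eq_of_K_L (x : Ext K L 1) : ∃ c : k, x = c • R.extKL := by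
  have := R.projective_Q
  obtain ⟨y, rfl⟩ := exists_extClass_comp_eq R.shortExact_γ (n := 0) (by omega) x
  obtain ⟨f, rfl⟩ := homEquiv₀.symm.surjective y
  obtain ⟨c, rfl⟩ := R.hom_P_L f
  refine ⟨c, ?_⟩
  have : homEquiv₀.symm (c • π) = c • mk₀ π := mk₀_smul c _
  rw [this, comp_smul]
  rfl

theorem exists_smul_eq_of_L_L (x : Ext L L 2) : ∃ c : k, x = c • R.extLL := by
  have := R.projective_P
  obtain ⟨y, rfl⟩ := exists_extClass_comp_eq R.shortExact_π (n := 1) (by omega) x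
  obtain ⟨c, rfl⟩ := R.exists_smul_eq_of_K_L y
  exact ⟨c, comp_smul _ _ _ _⟩

/-- `extLL` is the image of `π` under two connecting maps, `Hom(P, L) → Ext^1(K, L) → Ext^2(L, L)`.
The first is injective because `Hom(Q, L) = 0`, the second because `Ext^1(P, L) = 0`. -/
theorem extLL_ne_zero : R.extLL ≠ 0 := by
  have := R.projective_P
  intro h
  have h₁ : R.extKL = 0 := extClass_comp_succ_eq_zero R.shortExact_π _ h
  have h₂ : mk₀ π = 0 := extClass_comp_eq_zero_of_hom R.shortExact_γ _ R.hom_Q_L h₁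
  exact R.π_ne_zero ((mk₀_eq_zero_iff π).mp h₂)

theorem id_ne_zero : mk₀ (𝟙 L) ≠ 0 := by
  rw [Ne, mk₀_eq_zero_iff]
  intro h
  exact R.π_ne_zero (by rw [← Category.comp_id π, h, Limits.comp_zero])

/-- The one-dimensionality of `Ext^2(L, L)`. -/
theorem exists_linearEquiv : Nonempty (Ext L L 2 ≃ₗ[k] k) := by
  refine ⟨(LinearEquiv.ofBijective (LinearMap.toSpanSingleton k _ R.extLL) ⟨?_, ?_⟩).symm⟩
  · exact smul_left_injective k R.extLL_ne_zero
  · intro x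
    obtain ⟨c, rfl⟩ := R.exists_smul_eq_of_L_L x
    exact ⟨c, rfl⟩

/-- In degrees 0 and 2 one factor is a multiple of the identity, so the pairing is `ε` up to
scalars; in the middle both spaces are zero. -/
theorem isDual_L (ε : Ext L L 2 ≃ₗ[k] k) : IsDual ε.toLinearMap L where
  vanish j hj := R.subsingleton_of_two_lt L hj
  bijective {i j} h := by
    obtain ⟨rfl, rfl⟩ | ⟨rfl, rfl⟩ | ⟨rfl, rfl⟩ :
      (i = 0 ∧ j = 2) ∨ (i = 1 ∧ j = 1) ∨ (i = 2 ∧ j = 0) := by omega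
    · constructor
      · rw [injective_iff_map_eq_zero]
        intro a ha
        obtain ⟨c, rfl⟩ := R.exists_smul_id_eq a
        have := LinearMap.congr_fun ha (ε.symm 1)
        rw [pairing_apply, smul_comp, mk₀_id_comp] at this
        simp at this
        rw [this, zero_smul]
      · refine fun φ => ⟨φ (ε.symm 1) • mk₀ (𝟙 L), LinearMap.ext fun b => ?_⟩
        rw [pairing_apply, smul_comp, mk₀_id_comp]
        obtain ⟨c, rfl⟩ := ε.symm.surjective b
        simp only [map_smul, LinearEquiv.coe_coe, LinearEquiv.apply_symm_apply, smul_eq_mul]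
        rw [mul_comm, ← smul_eq_mul, ← map_smul, ← map_smul, smul_eq_mul, mul_one]
    · have := R.subsingleton_one
      refine ⟨fun x y _ => Subsingleton.elim x y, fun φ => ⟨0, LinearMap.ext fun b => ?_⟩⟩
      rw [Subsingleton.elim b 0, map_zero, map_zero]
    · constructor
      · rw [injective_iff_map_eq_zero]
        intro a ha
        have := LinearMap.congr_fun ha (mk₀ (𝟙 L))
        rw [pairing_apply, comp_mk₀_id] at this
        simpa using this
      · refine fun φ => ⟨ε.symm (φ (mk₀ (𝟙 L))), LinearMap.ext fun b => ?_⟩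
        obtain ⟨c, rfl⟩ := R.exists_smul_id_eq b
        rw [map_smul, map_smul, pairing_apply, comp_mk₀_id]
        simp

/-- Only `Ext^1(L, K)` and `Ext^1(K, L)` survive. Each is spanned by one class, and the product of
these classes is `extLL`, on which `ε` does not vanish. -/
theorem isDual_K (ε : Ext L L 2 ≃ₗ[k] k) : IsDual ε.toLinearMap K where
  vanish j hj := R.subsingleton_of_one_lt L (by omega)
  bijective {i j} h := by
    obtain ⟨rfl, rfl⟩ | ⟨rfl, rfl⟩ | ⟨rfl, rfl⟩ :
      (i = 0 ∧ j = 2) ∨ (i = 1 ∧ j = 1) ∨ (i = 2 ∧ j = 0) := by omega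
    · have := subsingleton_zero_of_hom R.hom_L_K
      have := R.subsingleton_of_one_lt L (i := 2) (by omega)
      refine ⟨fun x y _ => Subsingleton.elim x y, fun φ => ⟨0, LinearMap.ext fun b => ?_⟩⟩
      rw [Subsingleton.elim b 0, map_zero, map_zero]
    · have hne : ε R.extLL ≠ 0 := by simpa using R.extLL_ne_zero
      constructor
      · rw [injective_iff_map_eq_zero]
        intro a ha
        obtain ⟨c, rfl⟩ := R.exists_smul_eq_of_L_K a
        have := LinearMap.congr_fun ha R.extKL
        rw [pairing_apply, smul_comp, map_smul] at this
        have : c = 0 := (mul_eq_zero.mp this).resolve_right hne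
        rw [this, zero_smul]
      · refine fun φ => ⟨(φ R.extKL / ε R.extLL) • R.shortExact_π.extClass,
          LinearMap.ext fun b => ?_⟩
        obtain ⟨c, rfl⟩ := R.exists_smul_eq_of_K_L b
        rw [map_smul _ c, map_smul φ, pairing_apply, smul_comp, map_smul]
        exact congrArg _ (div_mul_cancel₀ _ hne)
    · have := subsingleton_zero_of_hom R.hom_K_L
      have := R.subsingleton_two
      refine ⟨fun x y _ => Subsingleton.elim x y, fun φ => ⟨0, LinearMap.ext fun b => ?_⟩⟩
      rw [Subsingleton.elim b 0, map_zero, map_zero]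

end IsSphericalResolution

end CategoryTheory.Abelian.Ext

/-! ### The structure of the algebra `T^2_0` -/

namespace T20

/-- The slice red, red, black. -/
def slice02 : Slice 2 1 :=
  ⟨![Strand.red, Strand.red, Strand.black], by decide⟩

/-- The slice black, red, red. -/
def slice00 : Slice 2 1 :=
  ⟨![Strand.black, Strand.red, Strand.red], by decide⟩

theorem slice_cases (s : Slice 2 1) : s = slice00 ∨ s = slice01 ∨ s = slice02 := by
  revert s
  decide

/-- The matrices by which the elementary diagrams act on the left module spanned by the diagrams
with bottom red, red, black. -/
def elementaryMatrix : Elementary 2 1 → Matrix (Fin 3) (Fin 3) ℤ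
  -- The ordered basis is `e₂, b, a * b`, on which matrices act by columns. Entries are integers so
  -- that relations can be decided independently of the field.
  | .idem s => if s = slice01 then !![0, 0, 0; 0, 1, 0; 0, 0, 0] else
      if s = slice02 then !![1, 0, 0; 0, 0, 0; 0, 0, 1] else 0
  | .dot s i => if s = slice02 ∧ i = 2 then !![0, 0, 0; 0, 0, 0; 1, 0, 0] else 0
  | .cross s i _ _ => if i = 1 then if s = slice01 then !![0, 0, 0; 0, 0, 0; 0, 1, 0] else
      if s = slice02 then !![0, 0, 0; 1, 0, 0; 0, 0, 0] else 0 else 0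

variable (k : Type u) [Field k]

/-- The homomorphism from stacks of diagrams to matrices. -/
def stackMatrix : Stendhal.Stack k 2 1 →ₐ[k] Matrix (Fin 3) (Fin 3) k :=
  FreeAlgebra.lift k fun x => (Int.castRingHom k).mapMatrix (elementaryMatrix x)

theorem stackMatrix_ι (x : Elementary 2 1) : stackMatrix k (FreeAlgebra.ι k x) =
    (Int.castRingHom k).mapMatrix (elementaryMatrix x) :=
  FreeAlgebra.lift_ι_apply _ _

theorem stackMatrix_mul (x y : Elementary 2 1) :
    stackMatrix k (FreeAlgebra.ι k x * FreeAlgebra.ι k y) =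
      (Int.castRingHom k).mapMatrix (elementaryMatrix x * elementaryMatrix y) := by
  rw [map_mul, map_mul, stackMatrix_ι, stackMatrix_ι]

/-- Both sides of each applicable relation come from integer matrices, and there are finitely many
slices and positions. The identities are therefore checked over `ℤ` and mapped to `k`. -/
theorem stackMatrix_rel {x y : Stendhal.Stack k 2 1} (h : Stendhal.Rel k 2 1 x y) :
    stackMatrix k x = stackMatrix k y := by
  induction h with
  | idem_mul_idem s t =>
    rw [apply_ite (stackMatrix k)]
    rw [stackMatrix_mul, stackMatrix_ι, map_zero,
      ← map_zero (RingHom.mapMatrix (Int.castRingHom k)),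
      ← apply_ite (RingHom.mapMatrix _)]
    congr 1
    revert s t
    decide +kernel
  | sum_idem =>
    simp only [map_sum, map_one, stackMatrix_ι]
    rw [← map_sum, ← map_one (RingHom.mapMatrix (Int.castRingHom k))]
    congr 1
    decide +kernel
  | dot_red s i hi =>
    rw [stackMatrix_ι, map_zero, ← map_zero (RingHom.mapMatrix (Int.castRingHom k))]
    congr 1
    revert s i
    decide +kernel
  | cross_red s i j h hi hj =>
    rw [stackMatrix_ι, map_zero, ← map_zero (RingHom.mapMatrix (Int.castRingHom k))]
    congr 1
    revert s i j
    decide +kernel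
  | violating s i h hi =>
    rw [stackMatrix_ι, map_zero, ← map_zero (RingHom.mapMatrix (Int.castRingHom k))]
    congr 1
    revert s i
    decide +kernel
  -- These relations, and the triple relations after them, require two black strands, but there is
  -- only one.
  | nilHecke_top s i j h hi hj | nilHecke_bottom s i j h hi hj | black_bigon s i j h hi hj =>
    exfalso
    revert s i j
    decide +kernel
  | black_triple s i j l hij hjl hi hj hl | red_middle_triple s i j l hij hjl hi hj hl
  | red_right_triple s i j l hij hjl hi hj hl | red_left_triple s i j l hij hjl hi hj hl =>
    exfalso
    revert s i j l
    decide +kernel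
  | dot_bottom s i | dot_top s i =>
    simp only [stackMatrix_mul, stackMatrix_ι]
    congr 1
    revert s i
    decide +kernel
  | cross_bottom s i j h | cross_top s i j h | red_right_dot s i j h hi hj
  | red_left_dot s i j h hi hj | red_right_bigon s i j h hi hj | red_left_bigon s i j h hi hj =>
    simp only [stackMatrix_mul, stackMatrix_ι]
    congr 1
    revert s i j
    decide +kernel
  | dot_comm_dot s i j =>
    rw [stackMatrix_mul, stackMatrix_mul]
    congr 1
    revert s i j
    decide +kernel
  | cross_comm_dot s i j h l hi hj =>
    rw [stackMatrix_mul, stackMatrix_mul]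
    congr 1
    revert s i j l
    decide +kernel
  -- Two distant crossings need four strands.
  | cross_comm_cross s i j i' j' h h' hd =>
    exfalso
    omega

/-- The matrix representation of `T^2_0`. -/
def toMatrix : T20 k →ₐ[k] Matrix (Fin 3) (Fin 3) k :=
  RingQuot.liftAlgHom k ⟨stackMatrix k, fun _ _ h => stackMatrix_rel k h⟩

/-! ### Multiplication table and basis of the algebra -/

/-- The diagram of vertical strands red, black, red. -/
abbrev e₁ : T20 k := StendhalAlgebra.idem k slice01

/-- The diagram of vertical strands red, red, black. -/
abbrev e₂ : T20 k := StendhalAlgebra.idem k slice02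

/-- The element of the algebra given by an elementary diagram. -/
def diagram (x : Elementary 2 1) : T20 k :=
  RingQuot.mkAlgHom k (Stendhal.Rel k 2 1) (FreeAlgebra.ι k x)

/-- The crossing from red, black, red to red, red, black. -/
def a : T20 k := diagram k (.cross slice01 1 2 rfl)

/-- The crossing from red, red, black to red, black, red. -/
def b : T20 k := diagram k (.cross slice02 1 2 rfl)

variable {k}

theorem toMatrix_diagram (x : Elementary 2 1) :
    toMatrix k (diagram k x) = (Int.castRingHom k).mapMatrix (elementaryMatrix x) :=
  (RingQuot.liftAlgHom_mkAlgHom_apply k _ _ _).trans (stackMatrix_ι k x)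

theorem mk_rel {x y : Stendhal.Stack k 2 1} (h : Stendhal.Rel k 2 1 x y) :
    RingQuot.mkAlgHom k (Stendhal.Rel k 2 1) x = RingQuot.mkAlgHom k (Stendhal.Rel k 2 1) y :=
  RingQuot.mkAlgHom_rel k h

theorem diagram_mul_diagram {x y : Elementary 2 1} {z : Stendhal.Stack k 2 1}
    (h : Stendhal.Rel k 2 1 (FreeAlgebra.ι k x * FreeAlgebra.ι k y) z) :
    diagram k x * diagram k y = RingQuot.mkAlgHom k (Stendhal.Rel k 2 1) z :=
  (map_mul (RingQuot.mkAlgHom k (Stendhal.Rel k 2 1)) _ _).symm.trans (mk_rel h)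

theorem idem_slice00 : StendhalAlgebra.idem k slice00 = 0 :=
  (mk_rel (.violating slice00 0 rfl rfl)).trans (map_zero _)

theorem e₁_mul_e₁ : e₁ k * e₁ k = e₁ k :=
  diagram_mul_diagram (.idem_mul_idem slice01 slice01)

theorem e₂_mul_e₂ : e₂ k * e₂ k = e₂ k :=
  diagram_mul_diagram (.idem_mul_idem slice02 slice02)

theorem e₁_mul_e₂ : e₁ k * e₂ k = 0 :=
  (diagram_mul_diagram (.idem_mul_idem slice01 slice02)).trans (map_zero _)

theorem e₂_mul_e₁ : e₂ k * e₁ k = 0 :=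
  (diagram_mul_diagram (.idem_mul_idem slice02 slice01)).trans (map_zero _)

theorem e₁_add_e₂ : e₁ k + e₂ k = 1 := by
  have h := mk_rel (k := k) .sum_idem
  have hs : (Finset.univ : Finset (Slice 2 1)) = {slice00, slice01, slice02} := by decide
  rw [map_one, map_sum, hs, Finset.sum_insert (by decide), Finset.sum_insert (by decide),
    Finset.sum_singleton] at h
  refine Eq.trans ?_ h
  change _ = StendhalAlgebra.idem k slice00 + (e₁ k + e₂ k)
  rw [idem_slice00, zero_add]

theorem swap_slice01_left : slice01.swap 0 1 = slice00 := by decide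

theorem swap_slice01_right : slice01.swap 1 2 = slice02 := by decide

theorem swap_slice02_right : slice02.swap 1 2 = slice01 := by decide

theorem a_mul_e₁ : a k * e₁ k = a k := diagram_mul_diagram (.cross_bottom slice01 1 2 rfl)

theorem e₂_mul_a : e₂ k * a k = a k := by
  have h := diagram_mul_diagram (k := k) (.cross_top slice01 1 2 rfl)
  rwa [swap_slice01_right] at h

theorem b_mul_e₂ : b k * e₂ k = b k := diagram_mul_diagram (.cross_bottom slice02 1 2 rfl)

theorem e₁_mul_b : e₁ k * b k = b k := by
  have h := diagram_mul_diagram (k := k) (.cross_top slice02 1 2 rfl)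
  rwa [swap_slice02_right] at h

/-- The top slice of this crossing is black, red, red, whose idempotent is zero. -/
theorem cross_slice01_left : diagram k (.cross slice01 0 1 rfl) = 0 := by
  have h := diagram_mul_diagram (k := k) (.cross_top slice01 0 1 rfl)
  rw [swap_slice01_left] at h
  refine h.symm.trans ?_
  change StendhalAlgebra.idem k slice00 * _ = 0
  rw [idem_slice00, zero_mul]

/-- The dot equals the bigon with the left red strand, whose middle slice starts with black. The
bigon with the right red strand equals the same dot, which gives `b_mul_a`. -/
theorem dot_slice01 : diagram k (.dot slice01 1) = 0 := by
  have h := diagram_mul_diagram (k := k) (.red_left_bigon slice01 0 1 rfl rfl rfl)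
  refine h.symm.trans ?_
  rw [cross_slice01_left, mul_zero]

theorem b_mul_a : b k * a k = 0 := by
  have h := diagram_mul_diagram (k := k) (.red_right_bigon slice01 1 2 rfl rfl rfl)
  rw [swap_slice01_right] at h
  exact h.trans dot_slice01

theorem a_mul_b : a k * b k = diagram k (.dot slice02 2) := by
  have h := diagram_mul_diagram (k := k) (.red_left_bigon slice02 1 2 rfl rfl rfl)
  rwa [swap_slice02_right] at h

theorem diagram_slice00 {x : Elementary 2 1}
    (h : Stendhal.Rel k 2 1 (FreeAlgebra.ι k x * FreeAlgebra.ι k (.idem slice00))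
      (FreeAlgebra.ι k x)) : diagram k x = 0 := by
  refine (diagram_mul_diagram h).symm.trans ?_
  change _ * StendhalAlgebra.idem k slice00 = 0
  rw [idem_slice00, mul_zero]

theorem e₁_mul_a : e₁ k * a k = 0 := by rw [← e₂_mul_a, ← mul_assoc, e₁_mul_e₂, zero_mul]

theorem e₂_mul_b : e₂ k * b k = 0 := by rw [← e₁_mul_b, ← mul_assoc, e₂_mul_e₁, zero_mul]

theorem a_mul_e₂ : a k * e₂ k = 0 := by rw [← a_mul_e₁, mul_assoc, e₁_mul_e₂, mul_zero]

theorem b_mul_e₁ : b k * e₁ k = 0 := by rw [← b_mul_e₂, mul_assoc, e₂_mul_e₁, mul_zero]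

theorem a_mul_a : a k * a k = 0 := by
  nth_rw 1 [← a_mul_e₁]
  rw [mul_assoc, e₁_mul_a, mul_zero]

theorem b_mul_b : b k * b k = 0 := by
  nth_rw 1 [← b_mul_e₂]
  rw [mul_assoc, e₂_mul_b, mul_zero]

/-- The combination of the five basis diagrams with the given coefficients. -/
def comb (c : Fin 5 → k) : T20 k :=
  c 0 • e₁ k + c 1 • e₂ k + c 2 • a k + c 3 • b k + c 4 • (a k * b k)

theorem comb_mul_comb (c d : Fin 5 → k) : comb c * comb d = comb ![c 0 * d 0, c 1 * d 1,
    c 1 * d 2 + c 2 * d 0, c 0 * d 3 + c 3 * d 1, c 1 * d 4 + c 4 * d 1 + c 2 * d 3] := by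
  -- The simplifier associates products to the right, so the relations are also needed in front of a
  -- tail.
  have h₁ (x : T20 k) : b k * (a k * x) = 0 := by rw [← mul_assoc, b_mul_a, zero_mul]
  have h₂ (x : T20 k) : a k * (a k * x) = 0 := by rw [← mul_assoc, a_mul_a, zero_mul]
  have h₃ (x : T20 k) : e₁ k * (a k * x) = 0 := by rw [← mul_assoc, e₁_mul_a, zero_mul]
  have h₄ (x : T20 k) : e₂ k * (a k * x) = a k * x := by rw [← mul_assoc, e₂_mul_a]
  simp only [comb, add_mul, mul_add, smul_mul_smul_comm, mul_assoc, e₁_mul_e₁, e₁_mul_e₂,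
    e₁_mul_a, e₁_mul_b, e₂_mul_e₁, e₂_mul_e₂, e₂_mul_a, e₂_mul_b, a_mul_e₁, a_mul_e₂, a_mul_a,
    b_mul_e₁, b_mul_e₂, b_mul_a, b_mul_b, h₁, h₂, h₃, h₄, mul_zero, smul_zero, add_zero, zero_add,
    Matrix.cons_val, add_smul]
  abel

theorem diagram_mem_range_comb (x : Elementary 2 1) : ∃ c : Fin 5 → k, comb c = diagram k x := by
  have h0 : ∃ c : Fin 5 → k, comb c = (0 : T20 k) := ⟨0, by simp [comb]⟩
  have hdot : ∀ s i, s.color i = Strand.red → diagram k (.dot s i) = 0 :=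
    fun s i h => (mk_rel (.dot_red s i h)).trans (map_zero _)
  have hcross : ∀ s i j h, s.color i = Strand.red → s.color j = Strand.red →
      diagram k (.cross s i j h) = 0 :=
    fun s i j h h₁ h₂ => (mk_rel (.cross_red s i j h h₁ h₂)).trans (map_zero _)
  cases x with
  | idem s =>
    obtain rfl | rfl | rfl := slice_cases s
    · exact h0.imp fun _ h => h.trans idem_slice00.symm
    · exact ⟨![1, 0, 0, 0, 0], by simp [comb]; rfl⟩
    · exact ⟨![0, 1, 0, 0, 0], by simp [comb]; rfl⟩
  | dot s i =>
    obtain rfl | rfl | rfl := slice_cases s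
    · rwa [diagram_slice00 (.dot_bottom _ _)]
    · fin_cases i
      · rwa [hdot _ _ rfl]
      · exact h0.imp fun _ h => h.trans dot_slice01.symm
      · rwa [hdot _ _ rfl]
    · fin_cases i
      · rwa [hdot _ _ rfl]
      · rwa [hdot _ _ rfl]
      · exact ⟨![0, 0, 0, 0, 1], by simp [comb]; exact a_mul_b⟩
  | cross s i j h =>
    obtain ⟨rfl, rfl⟩ | ⟨rfl, rfl⟩ : (i = 0 ∧ j = 1) ∨ (i = 1 ∧ j = 2) := by
      revert i j
      decide
    · obtain rfl | rfl | rfl := slice_cases s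
      · rwa [diagram_slice00 (.cross_bottom _ _ _ _)]
      · exact h0.imp fun _ h => h.trans cross_slice01_left.symm
      · rwa [hcross _ _ _ _ rfl rfl]
    · obtain rfl | rfl | rfl := slice_cases s
      · rwa [diagram_slice00 (.cross_bottom _ _ _ _)]
      · exact ⟨![0, 0, 1, 0, 0], by simp [comb]; rfl⟩
      · exact ⟨![0, 0, 0, 1, 0], by simp [comb]; rfl⟩

theorem comb_surjective : Function.Surjective (comb (k := k)) := by
  intro t
  obtain ⟨x, rfl⟩ := RingQuot.mkAlgHom_surjective k (Stendhal.Rel k 2 1) t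
  induction x using FreeAlgebra.induction with
  | grade0 r =>
    refine ⟨![r, r, 0, 0, 0], ?_⟩
    rw [AlgHom.commutes, Algebra.algebraMap_eq_smul_one]
    refine Eq.trans ?_ (congrArg (r • ·) (e₁_add_e₂ (k := k)))
    simp only [comb, Matrix.cons_val, zero_smul, add_zero]
    exact (smul_add _ _ _).symm
  | grade1 x => exact diagram_mem_range_comb x
  | mul x y hx hy =>
    obtain ⟨c, hc⟩ := hx
    obtain ⟨d, hd⟩ := hy
    exact ⟨_, (comb_mul_comb c d).symm.trans ((congrArg₂ _ hc hd).trans (map_mul _ _ _).symm)⟩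
  | add x y hx hy =>
    obtain ⟨c, hc⟩ := hx
    obtain ⟨d, hd⟩ := hy
    refine ⟨c + d, Eq.trans ?_ ((congrArg₂ _ hc hd).trans (map_add _ _ _).symm)⟩
    simp only [comb, Pi.add_apply, add_smul]
    abel

/-- The five coefficients can be read off from the entries, so the five diagrams are independent. -/
theorem toMatrix_comb (c : Fin 5 → k) :
    toMatrix k (comb c) = !![c 1, 0, 0; c 3, c 0, 0; c 4, c 2, c 1] := by
  have h₁ : toMatrix k (e₁ k) = _ := toMatrix_diagram _
  have h₂ : toMatrix k (e₂ k) = _ := toMatrix_diagram _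
  have h₃ : toMatrix k (a k) = _ := toMatrix_diagram _
  have h₄ : toMatrix k (b k) = _ := toMatrix_diagram _
  have h : slice02 ≠ slice01 := by decide
  simp only [comb, map_add, map_smul, map_mul, h₁, h₂, h₃, h₄, elementaryMatrix, if_neg h, if_true]
  ext i j
  fin_cases i <;> fin_cases j <;> simp [Matrix.mul_apply, Fin.sum_univ_three]

theorem comb_injective : Function.Injective (comb (k := k)) := by
  intro c d h
  have h := congrArg (toMatrix k) h
  rw [toMatrix_comb, toMatrix_comb] at h
  ext i
  fin_cases i
  · exact congr_fun₂ h 1 1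
  · exact congr_fun₂ h 0 0
  · exact congr_fun₂ h 2 1
  · exact congr_fun₂ h 1 0
  · exact congr_fun₂ h 2 0

instance : Module.Finite k (T20 k) := by
  let f : (Fin 5 → k) →ₗ[k] T20 k :=
    { toFun := comb
      map_add' := fun c d => by
        simp only [comb, Pi.add_apply, add_smul]
        abel
      map_smul' := fun r c => by simp [comb, smul_smul] }
  exact Module.Finite.of_surjective f comb_surjective

/-! ### The modules `P₁` and `P₂`, the radical, and the maps between them -/

variable (k)

/-- The projective module of the slice red, black, red. -/
abbrev P₁ : Submodule (T20 k) (T20 k) := StendhalAlgebra.projective k slice01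

/-- The projective module of the slice red, red, black. -/
abbrev P₂ : Submodule (T20 k) (T20 k) := StendhalAlgebra.projective k slice02

/-- The radical of `P₁`. -/
abbrev J : Submodule (T20 k) (P₁ k) := Module.jacobson (T20 k) (P₁ k)

variable {k}

theorem mem_projective_iff {s : Slice 2 1} (hs : StendhalAlgebra.idem k s * StendhalAlgebra.idem k s
    = StendhalAlgebra.idem k s) {x : T20 k} :
    x ∈ StendhalAlgebra.projective k s ↔ x * StendhalAlgebra.idem k s = x := by
  rw [Submodule.mem_span_singleton]
  constructor
  · rintro ⟨t, rfl⟩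
    rw [smul_eq_mul, mul_assoc, hs]
  · exact fun h => ⟨x, h⟩

/-- Right multiplication by the idempotent is a retraction of the free module `T` onto the left
ideal. -/
theorem projective_of_idem {s : Slice 2 1} (hs : StendhalAlgebra.idem k s * StendhalAlgebra.idem k s
    = StendhalAlgebra.idem k s) : Module.Projective (T20 k) (StendhalAlgebra.projective k s) := by
  refine Module.Projective.of_split (StendhalAlgebra.projective k s).subtype
    ((LinearMap.toSpanSingleton (T20 k) (T20 k) (StendhalAlgebra.idem k s)).codRestrict _
      fun t => Submodule.smul_mem _ t (Submodule.mem_span_singleton_self _))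
    (LinearMap.ext fun x => Subtype.ext ?_)
  exact (mem_projective_iff hs).mp x.2

theorem mem_P₁_iff {x : T20 k} : x ∈ P₁ k ↔ ∃ c d : k, x = comb ![c, 0, d, 0, 0] := by
  rw [mem_projective_iff e₁_mul_e₁]
  have h : comb ![1, 0, 0, 0, 0] = StendhalAlgebra.idem k slice01 := by simp [comb]
  constructor
  · intro hx
    obtain ⟨c, rfl⟩ := comb_surjective x
    refine ⟨c 0, c 2, ?_⟩
    rw [← hx, ← h, comb_mul_comb]
    simp
  · rintro ⟨c, d, rfl⟩
    rw [← h, comb_mul_comb]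
    simp

theorem mem_P₂_iff {x : T20 k} : x ∈ P₂ k ↔ ∃ c d f : k, x = comb ![0, c, 0, d, f] := by
  rw [mem_projective_iff e₂_mul_e₂]
  have h : comb ![0, 1, 0, 0, 0] = StendhalAlgebra.idem k slice02 := by simp [comb]
  constructor
  · intro hx
    obtain ⟨c, rfl⟩ := comb_surjective x
    refine ⟨c 1, c 3, c 4, ?_⟩
    rw [← hx, ← h, comb_mul_comb]
    simp
  · rintro ⟨c, d, f, rfl⟩
    rw [← h, comb_mul_comb]
    simp

variable (k) in
/-- The generator of `P₁`. -/
def gen₁ : P₁ k := ⟨e₁ k, Submodule.mem_span_singleton_self _⟩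

variable (k) in
/-- The generator of `P₂`. -/
def gen₂ : P₂ k := ⟨e₂ k, Submodule.mem_span_singleton_self _⟩

theorem smul_gen₁ (x : P₁ k) : x.1 • gen₁ k = x :=
  Subtype.ext ((mem_projective_iff e₁_mul_e₁).mp x.2)

theorem smul_gen₂ (x : P₂ k) : x.1 • gen₂ k = x :=
  Subtype.ext ((mem_projective_iff e₂_mul_e₂).mp x.2)

/-- Since `e₁ * a = 0`, multiplying by `c⁻¹ • e₁` removes the crossing and leaves the generator. -/
theorem eq_top_of_mem {N : Submodule (T20 k) (P₁ k)} {x : P₁ k} (hx : x ∈ N) {c d : k}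
    (h : x.1 = comb ![c, 0, d, 0, 0]) (hc : c ≠ 0) : N = ⊤ := by
  rw [eq_top_iff]
  intro y _
  have : (c⁻¹ • e₁ k) • x = gen₁ k := by
    have h' : comb ![c⁻¹, 0, 0, 0, 0] = c⁻¹ • e₁ k := by simp [comb]
    refine Subtype.ext ?_
    change (c⁻¹ • e₁ k) * x.1 = e₁ k
    rw [h, ← h', comb_mul_comb]
    simp [comb, hc]
  rw [← smul_gen₁ y, ← this]
  exact N.smul_mem _ (N.smul_mem _ hx)

variable (k) in
/-- The submodule of `P₁` spanned by the crossing. -/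
def crossSpan : Submodule (T20 k) (P₁ k) :=
  (Submodule.span (T20 k) {a k}).comap (P₁ k).subtype

theorem mem_crossSpan_iff {x : P₁ k} : x ∈ crossSpan k ↔ ∃ d : k, x.1 = comb ![0, 0, d, 0, 0] := by
  have h : comb ![0, 0, 1, 0, 0] = a k := by simp [comb]
  rw [crossSpan, Submodule.mem_comap, Submodule.mem_span_singleton]
  constructor
  · rintro ⟨t, ht⟩
    obtain ⟨c, rfl⟩ := comb_surjective t
    refine ⟨c 1, ht.symm.trans ?_⟩
    rw [smul_eq_mul, ← h, comb_mul_comb]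
    simp
  · rintro ⟨d, hd⟩
    refine ⟨comb ![0, d, 0, 0, 0], Eq.trans ?_ hd.symm⟩
    rw [smul_eq_mul, ← h, comb_mul_comb]
    simp

theorem crossSpan_ne_top : crossSpan k ≠ ⊤ := by
  intro h
  have : gen₁ k ∈ crossSpan k := by rw [h]; trivial
  obtain ⟨d, hd⟩ := mem_crossSpan_iff.mp this
  have h' : comb ![1, 0, 0, 0, 0] = e₁ k := by simp [comb]
  exact one_ne_zero (congrFun (comb_injective (h'.trans hd)) 0)

theorem le_crossSpan {N : Submodule (T20 k) (P₁ k)} (hN : N ≠ ⊤) : N ≤ crossSpan k := by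
  intro x hx
  obtain ⟨c, d, h⟩ := mem_P₁_iff.mp x.2
  by_cases hc : c = 0
  · exact mem_crossSpan_iff.mpr ⟨d, by rw [h, hc]⟩
  · exact absurd (eq_top_of_mem hx h hc) hN

/-- Every proper submodule lies in `crossSpan` by `le_crossSpan`, so `P₁` has exactly one maximal
submodule, which is then its radical. -/
theorem isCoatom_iff {N : Submodule (T20 k) (P₁ k)} : IsCoatom N ↔ N = crossSpan k := by
  constructor
  · intro h
    by_contra hne
    exact crossSpan_ne_top (h.2 _ (lt_of_le_of_ne (le_crossSpan h.1) hne))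
  · rintro rfl
    exact ⟨crossSpan_ne_top, fun N hN => by_contra fun h => (le_crossSpan h).not_gt hN⟩

variable (k) in
theorem J_eq : J k = crossSpan k := by
  simp [Module.jacobson, isCoatom_iff]

theorem isCoatom_J : IsCoatom (J k) := isCoatom_iff.mpr (J_eq k)

theorem mem_J_iff {x : P₁ k} : x ∈ J k ↔ ∃ d : k, x.1 = comb ![0, 0, d, 0, 0] := by
  rw [J_eq, mem_crossSpan_iff]

variable (k) in
theorem isSimpleModule_L₁ : IsSimpleModule (T20 k) (L₁ k) :=
  isSimpleModule_iff_isCoatom.mpr isCoatom_J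

variable (k) in
/-- The map `P₁ → P₂` given by the crossing. -/
def mulB : P₁ k →ₗ[T20 k] P₂ k :=
  (LinearMap.toSpanSingleton (T20 k) (T20 k) (b k)).restrict fun x _ =>
    (mem_projective_iff e₂_mul_e₂).mpr (by
      simp only [LinearMap.toSpanSingleton_apply, smul_eq_mul]
      rw [mul_assoc, b_mul_e₂])

variable (k) in
/-- The map `P₂ → P₁` given by the crossing. -/
def mulA : P₂ k →ₗ[T20 k] P₁ k :=
  (LinearMap.toSpanSingleton (T20 k) (T20 k) (a k)).restrict fun x _ =>
    (mem_projective_iff e₁_mul_e₁).mpr (by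
      simp only [LinearMap.toSpanSingleton_apply, smul_eq_mul]
      rw [mul_assoc, a_mul_e₁])

theorem mulB_apply {x : P₁ k} {c d : k} (h : x.1 = comb ![c, 0, d, 0, 0]) :
    (mulB k x).1 = comb ![0, 0, 0, c, d] := by
  have h' : comb ![0, 0, 0, 1, 0] = b k := by simp [comb]
  change x.1 * b k = _
  rw [h, ← h', comb_mul_comb]
  simp

theorem mulA_apply {x : P₂ k} {c d f : k} (h : x.1 = comb ![0, c, 0, d, f]) :
    (mulA k x).1 = comb ![0, 0, c, 0, 0] := by
  have h' : comb ![0, 0, 1, 0, 0] = a k := by simp [comb]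
  change x.1 * a k = _
  rw [h, ← h', comb_mul_comb]
  simp

variable (k) in
/-- The projective cover of the radical of `P₁`. -/
def toJ : P₂ k →ₗ[T20 k] J k := (mulA k).codRestrict (J k) fun x => by
  obtain ⟨c, d, f, h⟩ := mem_P₂_iff.mp x.2
  exact mem_J_iff.mpr ⟨c, mulA_apply h⟩

theorem toJ_eq_zero_iff {x : P₂ k} {c d f : k} (h : x.1 = comb ![0, c, 0, d, f]) :
    toJ k x = 0 ↔ c = 0 := by
  rw [← Subtype.coe_inj, ← Subtype.coe_inj]
  change (mulA k x).1 = 0 ↔ _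
  have h0 : (0 : T20 k) = comb 0 := by simp [comb]
  rw [mulA_apply h, h0]
  constructor
  · exact fun h => congrFun (comb_injective h) 2
  · rintro rfl
    congr 1
    ext i
    fin_cases i <;> rfl

theorem toJ_surjective : Function.Surjective (toJ k) := by
  intro y
  obtain ⟨d, hd⟩ := mem_J_iff.mp y.2
  have hx : comb ![0, d, 0, 0, 0] ∈ P₂ k := mem_P₂_iff.mpr ⟨d, 0, 0, rfl⟩
  refine ⟨⟨_, hx⟩, Subtype.ext (Subtype.ext ?_)⟩
  rw [hd]
  exact mulA_apply (x := ⟨_, hx⟩) rfl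

theorem mulB_injective : Function.Injective (mulB k) := by
  rw [injective_iff_map_eq_zero]
  intro x hx
  obtain ⟨c, d, h⟩ := mem_P₁_iff.mp x.2
  have h0 : (0 : T20 k) = comb 0 := by simp [comb]
  have := (mulB_apply h).symm.trans ((congrArg Subtype.val hx).trans h0)
  have hc : c = 0 := congrFun (comb_injective this) 3
  have hd : d = 0 := congrFun (comb_injective this) 4
  refine Subtype.ext (h.trans ?_)
  rw [hc, hd]
  simp [comb]

/-- `toJ` sends `e₂` to `a` and kills `b` and `a * b`, which are the images of `e₁` and `a` under
`mulB`. -/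
theorem exact_mulB_toJ : Function.Exact (mulB k) (toJ k) := by
  intro y
  obtain ⟨c, d, f, h⟩ := mem_P₂_iff.mp y.2
  rw [toJ_eq_zero_iff h]
  constructor
  · rintro rfl
    have hx : comb ![d, 0, f, 0, 0] ∈ P₁ k := mem_P₁_iff.mpr ⟨d, f, rfl⟩
    exact ⟨⟨_, hx⟩, Subtype.ext ((mulB_apply (x := ⟨_, hx⟩) rfl).trans h.symm)⟩
  · rintro ⟨x, rfl⟩
    obtain ⟨c', d', h'⟩ := mem_P₁_iff.mp x.2
    exact (congrFun (comb_injective ((mulB_apply h').symm.trans h)) 1).symm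

/-- The top slice of `a` is red, red, black. With its companions `e₂_smul_J` and `e₂_smul_quot` this
controls the morphisms in the resolution, since a morphism from `T * e` to `M` sends the generator
into `e • M`. -/
theorem e₁_smul_J (x : J k) : e₁ k • x = 0 := by
  obtain ⟨d, hd⟩ := mem_J_iff.mp x.2
  refine Subtype.ext (Subtype.ext ?_)
  change e₁ k * x.1.1 = 0
  rw [hd]
  simp [comb, e₁_mul_a]

theorem e₂_smul_J (x : J k) : e₂ k • x = x := by
  obtain ⟨d, hd⟩ := mem_J_iff.mp x.2
  refine Subtype.ext (Subtype.ext ?_)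
  change e₂ k * x.1.1 = x.1.1
  rw [hd]
  simp [comb, e₂_mul_a]

theorem exists_smul_mkQ (y : P₁ k ⧸ J k) :
    ∃ c : k, y = algebraMap k (T20 k) c • (J k).mkQ (gen₁ k) := by
  obtain ⟨x, rfl⟩ := (J k).mkQ_surjective y
  obtain ⟨c, d, h⟩ := mem_P₁_iff.mp x.2
  refine ⟨c, ?_⟩
  rw [← map_smul, ← sub_eq_zero, ← map_sub, Submodule.mkQ_apply, Submodule.Quotient.mk_eq_zero,
    mem_J_iff]
  refine ⟨d, ?_⟩
  change x.1 - algebraMap k (T20 k) c * e₁ k = _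
  rw [h, ← Algebra.smul_def]
  simp [comb]

theorem e₂_smul_quot (y : P₁ k ⧸ J k) : e₂ k • y = 0 := by
  obtain ⟨c, rfl⟩ := exists_smul_mkQ y
  rw [smul_smul, ← Algebra.commutes, mul_smul, ← map_smul]
  have : e₂ k • gen₁ k = 0 := Subtype.ext e₂_mul_e₁
  rw [this, map_zero, smul_zero]

theorem exists_smul_toJ (y : J k) :
    ∃ c : k, y = algebraMap k (T20 k) c • toJ k (gen₂ k) := by
  obtain ⟨d, hd⟩ := mem_J_iff.mp y.2
  refine ⟨d, Subtype.ext (Subtype.ext (hd.trans ?_))⟩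
  change _ = algebraMap k (T20 k) d * (e₂ k * a k)
  rw [← Algebra.smul_def, e₂_mul_a]
  simp [comb]

/-! ### The two simple modules -/

section Simple

variable {S : Type u} [AddCommGroup S] [Module (T20 k) S]

/-- Surjective linear maps with the same kernel have isomorphic codomains. -/
theorem nonempty_linearEquiv_of_ker_eq {R X Y Z : Type*} [Ring R] [AddCommGroup X] [Module R X]
    [AddCommGroup Y] [Module R Y] [AddCommGroup Z] [Module R Z] {f : X →ₗ[R] Y} {g : X →ₗ[R] Z}
    (hf : Function.Surjective f) (hg : Function.Surjective g)
    (h : LinearMap.ker f = LinearMap.ker g) : Nonempty (Y ≃ₗ[R] Z) :=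
  ⟨(f.quotKerEquivOfSurjective hf).symm ≪≫ₗ Submodule.quotEquivOfEq _ _ h ≪≫ₗ
    g.quotKerEquivOfSurjective hg⟩

/-- As `e₁ + e₂ = 1`, some idempotent acts nontrivially on `S`, so `S` is a quotient of `P₁` or of
`P₂`. It remains to identify the kernel. -/
theorem simple_cases [IsSimpleModule (T20 k) S] :
    Nonempty (S ≃ₗ[T20 k] (P₁ k ⧸ J k)) ∨ Nonempty (S ≃ₗ[T20 k] J k) := by
  by_cases h : ∃ s : S, e₁ k • s ≠ 0
  · left
    obtain ⟨s, hs⟩ := h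
    let g : P₁ k →ₗ[T20 k] S := LinearMap.toSpanSingleton (T20 k) S s ∘ₗ (P₁ k).subtype
    have hg : g ≠ 0 := fun h => hs (LinearMap.congr_fun h (gen₁ k))
    have hg' := LinearMap.surjective_of_ne_zero hg
    refine nonempty_linearEquiv_of_ker_eq hg' (J k).mkQ_surjective ?_
    -- The kernel of a surjection to a simple module is maximal, and `P₁` has only one maximal
    -- submodule.
    rw [Submodule.ker_mkQ, J_eq, ← isCoatom_iff]
    exact LinearMap.isCoatom_ker_of_surjective hg'
  · right
    push Not at h
    have := IsSimpleModule.nontrivial (T20 k) S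
    obtain ⟨s, hs⟩ := exists_ne (0 : S)
    let g : P₂ k →ₗ[T20 k] S := LinearMap.toSpanSingleton (T20 k) S s ∘ₗ (P₂ k).subtype
    have he : e₂ k • s = s := by
      rw [← zero_add (e₂ k • s), ← h s, ← add_smul, e₁_add_e₂, one_smul]
    have hg : g ≠ 0 := fun h => hs (he.symm.trans (LinearMap.congr_fun h (gen₂ k)))
    have hg' := LinearMap.surjective_of_ne_zero hg
    refine nonempty_linearEquiv_of_ker_eq hg' toJ_surjective ?_
    ext x
    obtain ⟨c, d, f, hx⟩ := mem_P₂_iff.mp x.2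
    rw [LinearMap.mem_ker, LinearMap.mem_ker, toJ_eq_zero_iff hx]
    -- `b • s` lies in `e₁ • S = 0`. So `b` and `a * b` kill `s`, and only the coefficient of `e₂`
    -- matters.
    have hb : b k • s = 0 := by rw [← e₁_mul_b, mul_smul, h]
    have hgx : g x = algebraMap k (T20 k) c • s := by
      change x.1 • s = _
      rw [hx]
      simp only [comb, Matrix.cons_val, zero_smul, zero_add, add_zero, add_smul]
      simp only [Algebra.smul_def, mul_smul, he, hb, smul_zero, add_zero]
    rw [hgx]
    constructor
    · intro hc
      by_contra hne
      apply hs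
      rw [← one_smul (T20 k) s, ← map_one (algebraMap k (T20 k)), ← inv_mul_cancel₀ hne, map_mul,
        mul_smul, hc, smul_zero]
    · rintro rfl
      rw [map_zero, zero_smul]

end Simple

/-! ### The resolution of `L₁` and the existence of the duality -/

variable (k)

/-- The projection of `P₁` to its simple quotient. -/
def toL₁ : ModuleCat.of (T20 k) (P₁ k) ⟶ L₁ k := ModuleCat.ofHom (J k).mkQ

open Ext in
-- Here `K` is `J`, and `β`, `γ` are right multiplication by `b` and `a`. The conditions on
-- morphisms are checked on generators with the idempotents.
theorem isSphericalResolution : IsSphericalResolution k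
    (ModuleCat.ofHom (J k).subtype : ModuleCat.of (T20 k) (J k) ⟶ _)
    (toL₁ k) (ModuleCat.ofHom (mulB k))
    (ModuleCat.ofHom (toJ k)) where
  ι_π := by
    ext x
    exact (Submodule.Quotient.mk_eq_zero _).mpr x.2
  β_γ := by
    ext x
    exact congrArg (fun y => y.1.1) ((exact_mulB_toJ _).mpr ⟨x, rfl⟩)
  shortExact_π := by
    refine ShortComplex.ShortExact.mk' ?_ ?_ ?_
    · rw [ShortComplex.moduleCat_exact_iff]
      intro x hx
      exact ⟨⟨x, (Submodule.Quotient.mk_eq_zero _).mp hx⟩, rfl⟩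
    · exact (ModuleCat.mono_iff_injective _).mpr Subtype.val_injective
    · exact (ModuleCat.epi_iff_surjective _).mpr (J k).mkQ_surjective
  shortExact_γ := by
    refine ShortComplex.ShortExact.mk' ?_ ?_ ?_
    · rw [ShortComplex.moduleCat_exact_iff]
      intro x hx
      exact (exact_mulB_toJ x).mp hx
    · exact (ModuleCat.mono_iff_injective _).mpr mulB_injective
    · exact (ModuleCat.epi_iff_surjective _).mpr toJ_surjective
  projective_P := (IsProjective.iff_projective _).mp (projective_of_idem e₁_mul_e₁)
  projective_Q := (IsProjective.iff_projective _).mp (projective_of_idem e₂_mul_e₂)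
  hom_P_K f := by
    ext1
    refine LinearMap.ext fun x => ?_
    rw [← smul_gen₁ x, map_smul]
    have : gen₁ k = e₁ k • gen₁ k := Subtype.ext e₁_mul_e₁.symm
    rw [this, map_smul, e₁_smul_J, smul_zero]
    rfl
  hom_Q_L f := by
    ext1
    refine LinearMap.ext fun x => ?_
    rw [← smul_gen₂ x, map_smul]
    have : gen₂ k = e₂ k • gen₂ k := Subtype.ext e₂_mul_e₂.symm
    rw [this, map_smul]
    exact (congrArg _ (e₂_smul_quot _)).trans (smul_zero (A := P₁ k ⧸ J k) _)
  hom_K_L f := by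
    ext1
    refine LinearMap.ext fun x => ?_
    rw [← e₂_smul_J x, map_smul]
    exact e₂_smul_quot _
  hom_P_L f := by
    obtain ⟨c, hc⟩ := exists_smul_mkQ (f.hom (gen₁ k))
    refine ⟨c, ?_⟩
    ext1
    refine LinearMap.ext fun x => ?_
    rw [← smul_gen₁ x, map_smul, map_smul]
    exact congrArg _ hc
  hom_K_K f := by
    obtain ⟨c, hc⟩ := exists_smul_toJ (f.hom (toJ k (gen₂ k)))
    refine ⟨c, ?_⟩
    ext1
    refine LinearMap.ext fun x => ?_
    obtain ⟨y, rfl⟩ := toJ_surjective x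
    rw [← smul_gen₂ y, map_smul, map_smul, map_smul]
    exact congrArg _ hc
  π_ne_zero h := by
    have : J k = ⊤ := by
      rw [← (J k).ker_mkQ, LinearMap.ker_eq_top]
      exact congrArg ModuleCat.Hom.hom h
    exact isCoatom_J.1 this

variable {k} in
theorem isFiniteLength (M : Type u) [AddCommGroup M] [Module (T20 k) M] [Module.Finite (T20 k) M] :
    IsFiniteLength (T20 k) M := by
  have : IsNoetherian (T20 k) (T20 k) := isNoetherian_of_tower k inferInstance
  have : IsArtinian (T20 k) (T20 k) := isArtinian_of_tower k inferInstance
  have : IsNoetherianRing (T20 k) := ‹_›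
  have : IsArtinianRing (T20 k) := ‹_›
  exact isFiniteLength_iff_isNoetherian_isArtinian.mpr ⟨inferInstance, inferInstance⟩

variable {k} in
open Ext in
theorem isDual_of_isFiniteLength (ε : Ext.{u} (L₁ k) (L₁ k) 2 ≃ₗ[k] k) {M : Type u} [AddCommGroup M]
    [Module (T20 k) M] (hM : IsFiniteLength (T20 k) M) :
    IsDual ε.toLinearMap (ModuleCat.of (T20 k) M) := by
  have R := isSphericalResolution k
  induction hM with
  | of_subsingleton => exact .of_isZero (ModuleCat.isZero_of_subsingleton _)
  | @of_simple_quotient M _ _ N _ _ ih =>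
    -- The quotient is replaced by an isomorphic module `X` inside the short exact sequence, so
    -- duality for `L₁` and `J` applies without being transported.
    have key (X : ModuleCat.{u} (T20 k)) (e : (M ⧸ N) ≃ₗ[T20 k] X) (hX : IsDual ε.toLinearMap X) :
        IsDual ε.toLinearMap (ModuleCat.of (T20 k) M) := by
      let S := ShortComplex.mk (ModuleCat.ofHom N.subtype)
        (ModuleCat.ofHom (e.toLinearMap ∘ₗ N.mkQ)) (by ext x; simp)
      have hS : S.ShortExact := by
        refine ShortComplex.ShortExact.mk' ?_ ?_ ?_
        · rw [ShortComplex.moduleCat_exact_iff]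
          intro x hx
          have hx' : e (N.mkQ x) = 0 := hx
          rw [LinearEquiv.map_eq_zero_iff, Submodule.mkQ_apply,
            Submodule.Quotient.mk_eq_zero] at hx'
          exact ⟨⟨x, hx'⟩, rfl⟩
        · exact (ModuleCat.mono_iff_injective _).mpr Subtype.val_injective
        · exact (ModuleCat.epi_iff_surjective _).mpr (e.surjective.comp N.mkQ_surjective)
      exact IsDual.of_shortExact hS ih hX (R.subsingleton_of_two_lt _ (by omega))
    obtain ⟨⟨e⟩⟩ | ⟨⟨e⟩⟩ := simple_cases (k := k) (S := M ⧸ N)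
    · exact key (L₁ k) e (R.isDual_L ε)
    · exact key (ModuleCat.of _ (J k)) e (R.isDual_K ε)

open Ext in
theorem nonempty_extDuality : Nonempty (ExtDuality k) := by
  have R := isSphericalResolution k
  obtain ⟨ε⟩ := R.exists_linearEquiv
  have hε (M : ModuleCat.{u} (T20 k)) [Module.Finite (T20 k) M] : IsDual ε.toLinearMap M :=
    isDual_of_isFiniteLength ε (isFiniteLength M)
  exact ⟨{
    iso := fun M _ i j h => LinearEquiv.ofBijective (pairing ε.toLinearMap M h)
      ((hε M).bijective h)
    natural := fun M N _ _ i p j i' j' hi hj h h' a f b => pairing_comp hi hj h h' a f b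
    vanish_left := fun M _ i hi => R.subsingleton_of_two_lt M hi
    vanish_right := fun M _ j hj => (hε M).vanish j hj }⟩

end T20

/-! ### The boundary of the tetrahedron is a sphere -/

namespace Tetrahedron

/-- The solid tetrahedron spanned by the origin and the three unit vectors. -/
def solid : Set (EuclideanSpace ℝ (Fin 3)) := {y | (∀ i, 0 ≤ y i) ∧ ∑ i, y i ≤ 1}

/-- The sum of the coordinates. -/
def coordSum : EuclideanSpace ℝ (Fin 3) →L[ℝ] ℝ := ∑ i, EuclideanSpace.proj i

theorem coordSum_apply (y : EuclideanSpace ℝ (Fin 3)) : coordSum y = ∑ i, y i := by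
  simp [coordSum]

theorem solid_eq : solid = (⋂ i : Fin 3, EuclideanSpace.proj (𝕜 := ℝ) i ⁻¹' Set.Ici 0) ∩
    coordSum ⁻¹' Set.Iic 1 := by
  ext y
  simp [solid, coordSum_apply]

/-- The solid is a finite intersection of closed half spaces, and nonzero linear functionals are
open maps, so interiors are taken on the half lines. -/
theorem interior_solid : interior solid = {y | (∀ i, 0 < y i) ∧ ∑ i, y i < 1} := by
  have h₁ (i : Fin 3) : IsOpenMap (EuclideanSpace.proj i : EuclideanSpace ℝ (Fin 3) →L[ℝ] ℝ) :=
    ContinuousLinearMap.isOpenMap _ fun c => ⟨EuclideanSpace.single i c, by simp⟩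
  have h₂ : IsOpenMap coordSum :=
    ContinuousLinearMap.isOpenMap _ fun c => ⟨EuclideanSpace.single 0 c, by
      simp [coordSum_apply]⟩
  rw [solid_eq, interior_inter, interior_iInter_of_finite]
  simp_rw [← (h₁ _).preimage_interior_eq_interior_preimage (EuclideanSpace.proj _).continuous,
    ← h₂.preimage_interior_eq_interior_preimage coordSum.continuous, interior_Ici, interior_Iic]
  ext y
  simp [coordSum_apply]

theorem isClosed_solid : IsClosed solid := by
  rw [solid_eq]
  exact (isClosed_iInter fun i => isClosed_Ici.preimage (EuclideanSpace.proj _).continuous).inter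
    (isClosed_Iic.preimage coordSum.continuous)

theorem mem_frontier_solid {y : EuclideanSpace ℝ (Fin 3)} :
    y ∈ frontier solid ↔ y ∈ solid ∧ ((∃ i, y i = 0) ∨ ∑ i, y i = 1) := by
  rw [isClosed_solid.frontier_eq, interior_solid, Set.mem_sdiff]
  refine and_congr_right fun hy => ?_
  simp only [Set.mem_ofPred_eq, not_and_or, not_forall, not_lt]
  refine or_congr (exists_congr fun i => ?_) ?_
  · exact ⟨fun h => le_antisymm h (hy.1 i), fun h => h.le⟩
  · exact ⟨fun h => le_antisymm hy.2 h, fun h => h.ge⟩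

theorem convex_solid : Convex ℝ solid := by
  rw [solid_eq]
  exact (convex_iInter fun i => (convex_Ici 0).linear_preimage
    (EuclideanSpace.proj (𝕜 := ℝ) i).toLinearMap).inter
    ((convex_Iic 1).linear_preimage coordSum.toLinearMap)

theorem isBounded_solid : Bornology.IsBounded solid := by
  -- All coordinates lie in `[0, 1]`, so the squared norm is at most 3, which is below `2 ^ 2`.
  refine (Metric.isBounded_closedBall (x := 0) (r := 2)).subset fun y hy => ?_
  have h (i) : y i ≤ 1 :=
    (Finset.single_le_sum (fun j _ => hy.1 j) (Finset.mem_univ i)).trans hy.2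
  rw [mem_closedBall_zero_iff, EuclideanSpace.norm_eq, Real.sqrt_le_left (by norm_num),
    Fin.sum_univ_three]
  simp only [Real.norm_eq_abs, sq_abs]
  nlinarith [h 0, h 1, h 2, hy.1 0, hy.1 1, hy.1 2]

theorem interior_solid_nonempty : (interior solid).Nonempty := by
  refine ⟨WithLp.toLp 2 fun _ => 1 / 4, ?_⟩
  rw [interior_solid]
  refine ⟨fun i => ?_, ?_⟩
  · norm_num
  · rw [Fin.sum_univ_three]
    norm_num

/-- The support is never empty because the coordinates sum to 1; so the only condition is that it is
not everything. -/
theorem mem_geometricRealization_iff {x : Fin 4 → ℝ} :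
    x ∈ geometricRealization sphereComplex ↔ x ∈ stdSimplex ℝ (Fin 4) ∧ ∃ v, x v = 0 := by
  refine and_congr_right fun hx => ?_
  change (Finset.Nonempty _ ∧ _ ≠ Finset.univ) ↔ _
  have hne : (Finset.univ.filter fun v => x v ≠ 0).Nonempty := by
    by_contra h
    rw [Finset.not_nonempty_iff_eq_empty, Finset.filter_eq_empty_iff] at h
    have h0 : ∑ v, x v = 0 := Finset.sum_eq_zero fun v hv => not_not.mp (h hv)
    exact zero_ne_one (h0.symm.trans hx.2)
  rw [Ne, Finset.filter_eq_self]
  simp [hne]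

/-- The projection of the boundary of the standard simplex to the boundary of the solid
tetrahedron. -/
def homeomorphFrontier : geometricRealization sphereComplex ≃ₜ frontier solid where
  toFun x := ⟨WithLp.toLp 2 fun i => x.1 i.succ, by
    obtain ⟨⟨h₀, h₁⟩, v, hv⟩ := mem_geometricRealization_iff.mp x.2
    rw [Fin.sum_univ_succ] at h₁
    refine mem_frontier_solid.mpr ⟨⟨fun i => h₀ _, ?_⟩, ?_⟩
    · have := h₀ 0
      simp only
      linarith
    -- The dropped coordinate is 1 minus the sum of the others. Its vanishing gives the slanted
    -- face; the other coordinates give the coordinate faces.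
    · refine Fin.cases (fun hv => Or.inr ?_) (fun i hi => Or.inl ⟨i, hi⟩) v hv
      simpa [hv] using h₁⟩
  invFun y := ⟨Fin.cons (1 - ∑ i, y.1 i) fun i => y.1 i, by
    obtain ⟨⟨h₀, h₁⟩, h⟩ := mem_frontier_solid.mp y.2
    refine mem_geometricRealization_iff.mpr ⟨⟨fun v => ?_, ?_⟩, ?_⟩
    · refine Fin.cases ?_ (fun i => ?_) v
      · simpa using h₁
      · simpa using h₀ i
    · rw [Fin.sum_univ_succ]
      simp
    · rcases h with ⟨i, hi⟩ | h
      · exact ⟨i.succ, by simpa using hi⟩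
      · exact ⟨0, by simp [h]⟩⟩
  left_inv x := by
    obtain ⟨⟨_, h₁⟩, _⟩ := mem_geometricRealization_iff.mp x.2
    rw [Fin.sum_univ_succ] at h₁
    refine Subtype.ext (funext fun v => ?_)
    refine Fin.cases ?_ (fun i => ?_) v
    · simp only [Fin.cons_zero]
      linarith
    · simp
  right_inv y := by
    refine Subtype.ext ?_
    ext i
    simp
  continuous_toFun := by
    refine Continuous.subtype_mk ?_ _
    exact (PiLp.continuous_toLp 2 _).comp
      (continuous_pi fun i => (continuous_apply i.succ).comp continuous_subtype_val)
  continuous_invFun := by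
    refine Continuous.subtype_mk (continuous_pi fun v => ?_) _
    refine Fin.cases ?_ (fun i => ?_) v
    · simp only [Fin.cons_zero]
      fun_prop
    · simp only [Fin.cons_succ]
      fun_prop

/-- The solid is bounded and convex with nonempty interior, so a homeomorphism of the ambient space
carries its frontier to the unit sphere. -/
theorem nonempty_homeomorph_sphere : Nonempty (geometricRealization sphereComplex ≃ₜ
    Metric.sphere (0 : EuclideanSpace ℝ (Fin 3)) 1) := by
  obtain ⟨h, -, -, hf⟩ := exists_homeomorph_image_interior_closure_frontier_eq_unitBall
    convex_solid interior_solid_nonempty isBounded_solid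
  exact ⟨homeomorphFrontier.trans ((h.image _).trans (Homeomorph.setCongr hf))⟩

end Tetrahedron

/-! ### The cohomology of the sphere -/

namespace SphereCohomology

open SimplicialCohomology

variable {k : Type u} [Field k]

theorem mem_sphereComplex {s : Finset (Fin 4)} :
    s ∈ sphereComplex ↔ s.Nonempty ∧ s ≠ Finset.univ := Iff.rfl

instance (s : Finset (Fin 4)) : Decidable (s ∈ sphereComplex) :=
  decidable_of_iff _ mem_sphereComplex.symm

theorem cochains_ext {m : ℕ} {f g : Finset (Fin 4) → k} (hf : f ∈ cochains sphereComplex k m)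
    (hg : g ∈ cochains sphereComplex k m)
    (h : ∀ s ∈ sphereComplex, s.card = m → f s = g s) : f = g := by
  ext s
  by_cases hs : s ∈ sphereComplex ∧ s.card = m
  · exact h s hs.1 hs.2
  · have h₁ : f s = 0 := by
      by_contra h'
      exact hs (hf s h')
    have h₂ : g s = 0 := by
      by_contra h'
      exact hs (hg s h')
    rw [h₁, h₂]

theorem coboundary_mem_cochains {m : ℕ} {f : Finset (Fin 4) → k}
    (hf : f ∈ cochains sphereComplex k m) :
    coboundary sphereComplex k f ∈ cochains sphereComplex k (m + 1) := by
  intro s hs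
  by_cases h : s ∈ sphereComplex
  · refine ⟨h, ?_⟩
    rw [coboundary_apply h] at hs
    obtain ⟨v, hv, hne⟩ := Finset.exists_ne_zero_of_sum_ne_zero hs
    have := (hf _ (right_ne_zero_of_mul hne)).2
    rw [Finset.card_erase_of_mem hv] at this
    have := Finset.card_pos.mpr ⟨v, hv⟩
    omega
  · exact absurd (coboundary_of_notMem h) hs

theorem coboundary_pair (f : Finset (Fin 4) → k) {x y : Fin 4} (h : x < y) :
    coboundary sphereComplex k f {x, y} = f {y} - f {x} := by
  rw [coboundary_apply (by revert x y; decide), Finset.sum_pair h.ne]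
  have e₁ : ({x, y} : Finset (Fin 4)).erase x = {y} := by revert x y; decide
  have e₂ : ({x, y} : Finset (Fin 4)).erase y = {x} := by revert x y; decide
  have e₃ : (({x, y} : Finset (Fin 4)).filter (· < x)).card = 0 := by revert x y; decide
  have e₄ : (({x, y} : Finset (Fin 4)).filter (· < y)).card = 1 := by revert x y; decide
  rw [e₁, e₂, e₃, e₄]
  ring

theorem coboundary_triple (f : Finset (Fin 4) → k) {x y z : Fin 4} (h : x < y) (h' : y < z) :
    coboundary sphereComplex k f {x, y, z} = f {y, z} - f {x, z} + f {x, y} := by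
  rw [coboundary_apply (by revert x y z; decide), Finset.sum_insert (by revert x y z; decide),
    Finset.sum_pair h'.ne]
  have e₁ : ({x, y, z} : Finset (Fin 4)).erase x = {y, z} := by revert x y z; decide
  have e₂ : ({x, y, z} : Finset (Fin 4)).erase y = {x, z} := by revert x y z; decide
  have e₃ : ({x, y, z} : Finset (Fin 4)).erase z = {x, y} := by revert x y z; decide
  have e₄ : (({x, y, z} : Finset (Fin 4)).filter (· < x)).card = 0 := by
    clear e₁ e₂ e₃
    revert x y z
    decide
  have e₅ : (({x, y, z} : Finset (Fin 4)).filter (· < y)).card = 1 := by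
    clear e₁ e₂ e₃ e₄
    revert x y z
    decide
  have e₆ : (({x, y, z} : Finset (Fin 4)).filter (· < z)).card = 2 := by
    clear e₁ e₂ e₃ e₄ e₅
    revert x y z
    decide
  rw [e₁, e₂, e₃, e₄, e₅, e₆]
  ring

theorem exists_pair {s : Finset (Fin 4)} (hs : s.card = 2) : ∃ x y, x < y ∧ s = {x, y} := by
  revert s
  decide

theorem exists_triple {s : Finset (Fin 4)} (hs : s.card = 3) :
    ∃ x y z, x < y ∧ y < z ∧ s = {x, y, z} := by
  revert s
  decide

/-- Every vertex is joined to the vertex 0 by an edge, on which the cocycle condition says that the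
two values agree. -/
theorem exists_smul_unit_eq (f : cocycles sphereComplex k 0) :
    ∃ c : k, (f : Finset (Fin 4) → k) = c • unit sphereComplex k := by
  refine ⟨f.1 {0}, cochains_ext f.2.1 (Submodule.smul_mem _ _ unit_mem_cocycles.1) ?_⟩
  intro s hs hc
  obtain ⟨x, rfl⟩ := Finset.card_eq_one.mp hc
  rw [Pi.smul_apply, unit, if_pos ⟨hs, hc⟩, smul_eq_mul, mul_one]
  rcases eq_or_ne x 0 with rfl | hx
  · rfl
  · have := congrFun (LinearMap.mem_ker.mp f.2.2) {0, x}
    rw [coboundary_pair _ (Fin.pos_of_ne_zero hx)] at this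
    exact sub_eq_zero.mp this

/-- Coning from the vertex 0 gives the primitive `g {x} = f {0, x}`. The cocycle condition on the
faces `{0, x, y}`, all of which belong to the complex, verifies it. -/
theorem mem_coboundaries_one (f : cocycles sphereComplex k 1) :
    (f : Finset (Fin 4) → k) ∈ coboundaries sphereComplex k 1 := by
  have hg : (fun s => if s.card = 1 ∧ 0 ∉ s then f.1 (insert 0 s) else 0) ∈
      cochains sphereComplex k 1 := by
    intro s hs
    simp only [ne_eq, ite_eq_right_iff, not_forall] at hs
    obtain ⟨⟨h, -⟩, -⟩ := hs
    refine ⟨?_, h⟩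
    revert s
    decide
  refine ⟨_, hg, cochains_ext (coboundary_mem_cochains hg) f.2.1 ?_⟩
  intro s hs hc
  obtain ⟨x, y, hxy, rfl⟩ := exists_pair hc
  rw [coboundary_pair _ hxy]
  have hy : 0 ≠ y := by
    rintro rfl
    exact absurd hxy (Fin.not_lt_zero x)
  rcases eq_or_ne 0 x with rfl | hx
  · simp [hy]
  · have := congrFun (LinearMap.mem_ker.mp f.2.2) {0, x, y}
    rw [coboundary_triple _ (Fin.pos_of_ne_zero hx.symm) hxy, Pi.zero_apply] at this
    simp only [Finset.card_singleton, Finset.mem_singleton, hx, hy, not_false_eq_true, and_self,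
      if_true]
    linear_combination -this

/-- The same cone works on the three triangles through 0. The remaining triangle `{1, 2, 3}` has no
tetrahedron above it; there the identity is exactly the vanishing on the fundamental cycle. -/
theorem mem_coboundaries_two (f : cocycles sphereComplex k 2) (hf : evalFundamental k f.1 = 0) :
    (f : Finset (Fin 4) → k) ∈ coboundaries sphereComplex k 2 := by
  have hg : (fun s => if s.card = 2 ∧ 0 ∉ s then f.1 (insert 0 s) else 0) ∈
      cochains sphereComplex k 2 := by
    intro s hs
    simp only [ne_eq, ite_eq_right_iff, not_forall] at hs
    obtain ⟨⟨h, -⟩, -⟩ := hs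
    refine ⟨?_, h⟩
    revert s
    decide
  refine ⟨_, hg, cochains_ext (coboundary_mem_cochains hg) f.2.1 ?_⟩
  intro s hs hc
  obtain ⟨x, y, z, hxy, hyz, rfl⟩ := exists_triple hc
  rw [coboundary_triple _ hxy hyz]
  have hy : 0 ≠ y := by
    rintro rfl
    exact absurd hxy (Fin.not_lt_zero x)
  have hz : 0 ≠ z := by
    rintro rfl
    exact absurd hyz (Fin.not_lt_zero y)
  have hc' {v w : Fin 4} (h : v < w) : ({v, w} : Finset (Fin 4)).card = 2 :=
    Finset.card_pair h.ne
  rcases eq_or_ne 0 x with rfl | hx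
  · simp [hy, hz, hc' hyz]
  · obtain ⟨rfl, rfl, rfl⟩ : x = 1 ∧ y = 2 ∧ z = 3 := by
      omega
    have h0 : (Finset.univ.erase 0 : Finset (Fin 4)) = {1, 2, 3} := by decide
    have h1 : (Finset.univ.erase 1 : Finset (Fin 4)) = {0, 2, 3} := by decide
    have h2 : (Finset.univ.erase 2 : Finset (Fin 4)) = {0, 1, 3} := by decide
    have h3 : (Finset.univ.erase 3 : Finset (Fin 4)) = {0, 1, 2} := by decide
    simp only [evalFundamental, LinearMap.coe_mk, AddHom.coe_mk, Fin.sum_univ_four, h0, h1, h2,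
      h3, Fin.val_zero, Fin.val_one, Fin.val_two] at hf
    rw [if_pos (by decide), if_pos (by decide), if_pos (by decide)]
    have e : ((3 : Fin 4) : ℕ) = 3 := rfl
    rw [e] at hf
    linear_combination -hf

theorem eq_zero_of_two_lt {n : ℕ} (hn : 2 < n) (f : cocycles sphereComplex k n) : f = 0 := by
  refine Subtype.ext (funext fun s => ?_)
  by_contra h
  obtain ⟨hs, hc⟩ := f.2.1 s h
  have := Finset.card_lt_univ_of_notMem (s := s) (x := (Finset.univ \ s).min' (by
    rw [Finset.sdiff_nonempty, Finset.univ_subset_iff]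
    exact hs.2)) (Finset.mem_sdiff.mp (Finset.min'_mem _ _)).2
  rw [Fintype.card_fin] at this
  omega

variable (k)

theorem exists_smul_one_eq (x : SimplicialH sphereComplex k 0) :
    ∃ c : k, x = c • (GradedMonoid.GOne.one : SimplicialH sphereComplex k 0) := by
  obtain ⟨f, rfl⟩ := SimplicialH.mk_surjective x
  obtain ⟨c, hc⟩ := exists_smul_unit_eq f
  refine ⟨c, ?_⟩
  have : f = c • ⟨unit sphereComplex k, unit_mem_cocycles⟩ := Subtype.ext hc
  rw [this, map_smul]
  rfl

theorem one_ne_zero : (GradedMonoid.GOne.one : SimplicialH sphereComplex k 0) ≠ 0 := by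
  intro h
  obtain ⟨g, hg, hgu⟩ := (Submodule.Quotient.mk_eq_zero _).mp h
  -- Coboundaries of degree 0 come from cochains on faces with no vertices, and there are none.
  have hg0 : g = 0 := by
    ext s
    by_contra hs
    obtain ⟨h₁, h₂⟩ := hg s hs
    exact h₁.1.ne_empty (Finset.card_eq_zero.mp h₂)
  have := congrFun hgu {0}
  rw [hg0, map_zero] at this
  have hmem : ({0} : Finset (Fin 4)) ∈ sphereComplex ∧ ({0} : Finset (Fin 4)).card = 1 := by decide
  have h1 : unit sphereComplex k {0} = 1 := if_pos hmem
  exact _root_.zero_ne_one (this.trans h1)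

theorem subsingleton {n : ℕ} (h₀ : n ≠ 0) (h₂ : n ≠ 2) :
    Subsingleton (SimplicialH sphereComplex k n) := by
  refine subsingleton_of_forall_eq 0 fun x => ?_
  obtain ⟨f, rfl⟩ := SimplicialH.mk_surjective x
  obtain rfl | hn : n = 1 ∨ 2 < n := by omega
  · exact (Submodule.Quotient.mk_eq_zero _).mpr (mem_coboundaries_one f)
  · rw [eq_zero_of_two_lt hn f, map_zero]

/-- The evaluation on the fundamental class. -/
def eval : SimplicialH sphereComplex k 2 →ₗ[k] k :=
  poincareTrace k ∘ₗ DirectSum.lof k ℕ (SimplicialH sphereComplex k) 2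

variable {k} in
theorem eval_mk (f : cocycles sphereComplex k 2) :
    eval k (SimplicialH.mk _ k 2 f) = evalFundamental k f.1 := by
  simp only [eval, poincareTrace, LinearMap.comp_apply]
  rfl

variable {k} in
theorem poincareTrace_of_ne {n : ℕ} (hn : n ≠ 2) (x : SimplicialH sphereComplex k n) :
    poincareTrace k (DirectSum.of (SimplicialH sphereComplex k) n x) = 0 :=
  (LinearMap.comp_apply _ _ _).trans
    ((congrArg _ (DirectSum.of_eq_of_ne n 2 x hn.symm)).trans (map_zero _))

theorem eval_bijective : Function.Bijective (eval k) := by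
  constructor
  · rw [injective_iff_map_eq_zero]
    intro x hx
    obtain ⟨f, rfl⟩ := SimplicialH.mk_surjective x
    rw [eval_mk] at hx
    exact (Submodule.Quotient.mk_eq_zero _).mpr (mem_coboundaries_two f hx)
  · intro c
    -- The face opposite to the vertex 0 has sign `+1` in the fundamental cycle, so the evaluation
    -- is `c`.
    let f : Finset (Fin 4) → k := fun s => if s = {1, 2, 3} then c else 0
    have hf : f ∈ cochains sphereComplex k 3 := by
      intro s hs
      simp only [f, ne_eq, ite_eq_right_iff, not_forall] at hs
      obtain ⟨rfl, -⟩ := hs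
      decide
    -- The coboundary is supported on faces with four vertices, and the full tetrahedron is not a
    -- face.
    have hf' : coboundary sphereComplex k f = 0 := by
      refine cochains_ext (coboundary_mem_cochains hf) (Submodule.zero_mem _) fun s hs hc => ?_
      exact absurd ((Finset.card_eq_iff_eq_univ s).mp hc) hs.2
    refine ⟨SimplicialH.mk _ k 2 ⟨f, hf, hf'⟩, ?_⟩
    rw [eval_mk]
    have h0 : (Finset.univ.erase 0 : Finset (Fin 4)) = {1, 2, 3} := by decide
    have h (i : Fin 4) (hi : i ≠ 0) : (Finset.univ.erase i : Finset (Fin 4)) ≠ {1, 2, 3} := by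
      revert i
      decide
    simp only [evalFundamental, LinearMap.coe_mk, AddHom.coe_mk]
    rw [Finset.sum_eq_single 0]
    · simp [f, h0]
    · intro i _ hi
      simp [f, h i hi]
    · simp

end SphereCohomology

/-! ### Frobenius structures on graded algebras of the size of `H^*(S²)` -/

namespace DualNumber

variable (k : Type*) [Field k]

/-- The coefficient of `ε`, a Frobenius form on the dual numbers. -/
def trace : DualNumber k →ₗ[k] k := TrivSqZeroExt.sndHom k k

/-- The comultiplication `1 ↦ 1 ⊗ ε + ε ⊗ 1`, `ε ↦ ε ⊗ ε` of the dual numbers. -/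
def comul : DualNumber k →ₗ[k] DualNumber k ⊗[k] DualNumber k :=
  (LinearMap.toSpanSingleton k _ (1 ⊗ₜ[k] eps + eps ⊗ₜ[k] 1)) ∘ₗ
      (TrivSqZeroExt.fstHom k k k).toLinearMap +
    (LinearMap.toSpanSingleton k _ (eps ⊗ₜ[k] eps)) ∘ₗ trace k

theorem isFrobenius : IsFrobenius k (trace k) (comul k) where
  perfect := by
    constructor
    · intro x y h
      have h₁ := LinearMap.congr_fun h 1
      have h₂ := LinearMap.congr_fun h eps
      simp [trace] at h₁ h₂
      exact TrivSqZeroExt.ext h₂ h₁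
    · intro φ
      -- For the trace form, `1` and `eps` are dual to each other, so the two coefficients are
      -- exchanged.
      refine ⟨TrivSqZeroExt.inl (φ eps) + TrivSqZeroExt.inr (φ 1), LinearMap.ext fun x => ?_⟩
      have hx : x = x.fst • 1 + x.snd • eps := by
        ext <;> simp
      conv_rhs => rw [hx]
      simp [trace]
      ring
  comul_dual x y z := by
    simp [comul, trace]
    ring

end DualNumber

/-- The transport of a Frobenius structure along an isomorphism of algebras. -/
theorem IsFrobenius.congr {k A B : Type*} [Field k] [Ring A] [Algebra k A] [Ring B] [Algebra k B]
    {ε : A →ₗ[k] k} {Δ : A →ₗ[k] A ⊗[k] A} (h : IsFrobenius k ε Δ) (e : A ≃ₐ[k] B)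
    {ε' : B →ₗ[k] k} (hε : ∀ x, ε' (e x) = ε x) :
    IsFrobenius k ε'
      (TensorProduct.map e.toLinearMap e.toLinearMap ∘ₗ Δ ∘ₗ e.symm.toLinearMap) where
  perfect := by
    constructor
    · intro x y hxy
      apply e.symm.injective
      apply h.perfect.1
      ext z
      have := LinearMap.congr_fun hxy (e z)
      simp only [LinearMap.comp_apply, LinearMap.mulLeft_apply] at this ⊢
      rw [← hε, ← hε]
      simpa using this
    · intro φ
      obtain ⟨x, hx⟩ := h.perfect.2 (φ ∘ₗ e.toLinearMap)
      refine ⟨e x, LinearMap.ext fun z => ?_⟩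
      have := LinearMap.congr_fun hx (e.symm z)
      simp only [LinearMap.comp_apply, LinearMap.mulLeft_apply, ← hε] at this ⊢
      simpa using this
  comul_dual x y z := by
    -- Pulled back along `e`, pairing with `w` becomes pairing with `e.symm w`; this reduces the
    -- claim to `h.comul_dual`.
    have hc (w : B) : (ε' ∘ₗ LinearMap.mulRight k w) ∘ₗ e.toLinearMap =
        ε ∘ₗ LinearMap.mulRight k (e.symm w) := by
      ext v
      simp [← hε]
    rw [LinearMap.comp_apply, LinearMap.comp_apply, ← LinearMap.comp_apply (TensorProduct.map _ _),
      ← TensorProduct.map_comp, hc, hc, h.comul_dual, ← hε]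
    simp

section Graded

variable {k : Type*} [Field k] {A : ℕ → Type*} [∀ n, AddCommGroup (A n)] [∀ n, Module k (A n)]
  [DirectSum.GRing A] [DirectSum.GAlgebra k A]

/-- A graded algebra that is one-dimensional in the degrees `0` and `2` and zero in all other
degrees is isomorphic to the algebra of dual numbers. -/
theorem exists_dualNumber_algEquiv
    (h₀ : ∀ x : A 0, ∃ c : k, x = c • (GradedMonoid.GOne.one : A 0))
    (h₁ : (GradedMonoid.GOne.one : A 0) ≠ 0)
    (hn : ∀ n, n ≠ 0 → n ≠ 2 → Subsingleton (A n)) (t : A 2 ≃ₗ[k] k) :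
    ∃ e : DualNumber k ≃ₐ[k] ⨁ n, A n,
      (∀ c, e (TrivSqZeroExt.inl c) = DirectSum.of A 0 (c • GradedMonoid.GOne.one)) ∧
      ∀ d, e (TrivSqZeroExt.inr d) = DirectSum.of A 2 (t.symm d) := by
  let ω : ⨁ n, A n := DirectSum.of A 2 (t.symm 1)
  -- The square lives in degree 4, where the algebra is zero. So `ω`, normalised by `t`, defines a
  -- homomorphism from the dual numbers.
  have hω : ω * ω = 0 := by
    have := hn (2 + 2) (by omega) (by omega)
    rw [DirectSum.of_mul_of, Subsingleton.elim (GradedMonoid.GMul.mul _ _) 0, map_zero]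
  let f : DualNumber k →ₐ[k] ⨁ n, A n := DualNumber.lift
    ⟨(Algebra.ofId k _, ω), hω, fun c => (Algebra.commutes c ω).symm⟩
  have hsmul (c : k) (n : ℕ) (x : A n) : c • DirectSum.of A n x = DirectSum.of A n (c • x) :=
    (map_smul (DirectSum.lof k ℕ A n) c x).symm
  have hf (x : DualNumber k) : f x = DirectSum.of A 0 (x.fst • GradedMonoid.GOne.one) +
      DirectSum.of A 2 (t.symm x.snd) := by
    have h : f x = algebraMap k _ x.fst + algebraMap k _ x.snd * ω :=
      DualNumber.lift_apply_apply _ _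
    rw [h, ← Algebra.smul_def, hsmul, ← map_smul, smul_eq_mul, mul_one,
      Algebra.algebraMap_eq_smul_one]
    exact congrArg (· + _) (hsmul _ _ _)
  have hbij : Function.Bijective f := by
    constructor
    · rw [injective_iff_map_eq_zero]
      intro x hx
      rw [hf] at hx
      have e₀ := congrArg (DirectSum.component k ℕ A 0) hx
      have e₂ := congrArg (DirectSum.component k ℕ A 2) hx
      rw [map_add, map_zero] at e₀ e₂
      erw [DirectSum.component.lof_self, DirectSum.component.of] at e₀
      erw [DirectSum.component.lof_self, DirectSum.component.of] at e₂
      simp [h₁] at e₀ e₂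
      exact TrivSqZeroExt.ext e₀ e₂
    · intro y
      change y ∈ f.range
      induction y using DirectSum.induction_on with
      | zero => exact zero_mem _
      | add x y hx hy => exact add_mem hx hy
      | of n x =>
        by_cases hn₀ : n = 0
        · subst hn₀
          obtain ⟨c, rfl⟩ := h₀ x
          exact ⟨TrivSqZeroExt.inl c, by simp [hf]⟩
        by_cases hn₂ : n = 2
        · subst hn₂
          exact ⟨TrivSqZeroExt.inr (t x), by simp [hf]⟩
        have := hn n hn₀ hn₂
        rw [Subsingleton.elim x 0, map_zero]
        exact zero_mem _
  exact ⟨AlgEquiv.ofBijective f hbij, fun c => (hf _).trans (by simp),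
    fun d => (hf _).trans (by simp)⟩

end Graded

/-! ### The counit of a duality and the comparison with the sphere -/

namespace ExtDuality

variable {k : Type u} [Field k] (θ : ExtDuality k)

theorem counit_of_two (a : Ext.{u} (L₁ k) (L₁ k) 2) : θ.counit (DirectSum.of (ExtSpace k) 2 a) =
    θ.iso (L₁ k) 2 0 rfl a (Ext.mk₀ (𝟙 (L₁ k))) :=
  congrArg (fun x => θ.iso (L₁ k) 2 0 rfl x (Ext.mk₀ (𝟙 (L₁ k))))
    (DirectSum.of_eq_same (β := ExtSpace k) 2 a)

theorem counit_of_ne {n : ℕ} (hn : n ≠ 2) (a : ExtSpace k n) :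
    θ.counit (DirectSum.of (ExtSpace k) n a) = 0 := by
  refine (congrArg (fun x => θ.iso (L₁ k) 2 0 rfl x (Ext.mk₀ (𝟙 (L₁ k))))
    (DirectSum.of_eq_of_ne (β := ExtSpace k) n 2 a hn.symm)).trans ?_
  exact (LinearMap.congr_fun (map_zero (θ.iso (L₁ k) 2 0 rfl)) _).trans rfl

/-- The counit in degree two. -/
def counitTwo : ExtSpace k 2 →ₗ[k] k := θ.counit ∘ₗ DirectSum.lof k ℕ (ExtSpace k) 2

/-- The counit of `a` is the value of the form `θ(a)` at the identity. As the identity spans `Ext⁰`,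
vanishing there forces `θ(a) = 0`, hence `a = 0`. Then the counit is nonzero on `extLL`, which gives
surjectivity. -/
theorem counitTwo_bijective : Function.Bijective θ.counitTwo := by
  have R := T20.isSphericalResolution k
  have h (a : Ext.{u} (L₁ k) (L₁ k) 2) :
      θ.counitTwo a = θ.iso (L₁ k) 2 0 rfl a (Ext.mk₀ (𝟙 (L₁ k))) :=
    θ.counit_of_two a
  have hinj : Function.Injective θ.counitTwo := by
    rw [injective_iff_map_eq_zero]
    intro (a : Ext.{u} (L₁ k) (L₁ k) 2) ha
    rw [h] at ha
    refine (LinearEquiv.map_eq_zero_iff (θ.iso (L₁ k) 2 0 rfl)).mp (LinearMap.ext fun b => ?_)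
    obtain ⟨c, rfl⟩ := R.exists_smul_id_eq b
    rw [map_smul, ha]
    simp
  refine ⟨hinj, ?_⟩
  have hne : θ.counitTwo R.extLL ≠ 0 := fun h0 =>
    R.extLL_ne_zero (hinj (h0.trans (map_zero _).symm))
  refine fun c => ⟨(c / θ.counitTwo R.extLL) • R.extLL, ?_⟩
  exact (map_smul θ.counitTwo _ _).trans (div_mul_cancel₀ _ hne)

end ExtDuality

/-- The Ext-algebra of `L₁` and the cohomology of the sphere are isomorphic Frobenius algebras. -/
theorem exists_frobenius_iso {k : Type u} [Field k] (θ : ExtDuality k) :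
      ∃ (Δ : ExtAlgebra k →ₗ[k] ExtAlgebra k ⊗[k] ExtAlgebra k)
        (ΔS : SphereCohomology k →ₗ[k] SphereCohomology k ⊗[k] SphereCohomology k)
        (Φ : ExtAlgebra k ≃ₐ[k] SphereCohomology k),
        IsFrobenius k θ.counit Δ ∧
        IsFrobenius k (poincareTrace k) ΔS ∧
        (∀ (n : ℕ) (a : ExtSpace k n), ∃ c : SimplicialH sphereComplex k n,
          Φ (DirectSum.of (ExtSpace k) n a) = DirectSum.of (SimplicialH sphereComplex k) n c) ∧
        poincareTrace k ∘ₗ Φ.toLinearMap = θ.counit ∧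
        ΔS ∘ₗ Φ.toLinearMap = TensorProduct.map Φ.toLinearMap Φ.toLinearMap ∘ₗ Δ := by
  have R := T20.isSphericalResolution k
  have hE₀ : ∀ x : ExtSpace k 0, ∃ c : k, x = c • (GradedMonoid.GOne.one : ExtSpace k 0) :=
    R.exists_smul_id_eq
  have hEn (n : ℕ) (h₀ : n ≠ 0) (h₂ : n ≠ 2) : Subsingleton (ExtSpace k n) := by
    obtain rfl | hn : n = 1 ∨ 2 < n := by omega
    · exact R.subsingleton_one
    · exact R.subsingleton_of_two_lt _ hn
  have hHn (n : ℕ) (h₀ : n ≠ 0) (h₂ : n ≠ 2) := SphereCohomology.subsingleton k h₀ h₂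
  let tE := LinearEquiv.ofBijective θ.counitTwo θ.counitTwo_bijective
  let tH := LinearEquiv.ofBijective _ (SphereCohomology.eval_bijective k)
  -- The generators of degree 2 are normalised by `tE` and `tH`, so both counits become the trace of
  -- the dual numbers.
  obtain ⟨e, he₀, he₂⟩ := exists_dualNumber_algEquiv hE₀ R.id_ne_zero hEn tE
  obtain ⟨e', he'₀, he'₂⟩ := exists_dualNumber_algEquiv (SphereCohomology.exists_smul_one_eq k)
    (SphereCohomology.one_ne_zero k) hHn tH
  have hε (x : DualNumber k) : θ.counit (e x) = DualNumber.trace k x := by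
    rw [← TrivSqZeroExt.inl_fst_add_inr_snd_eq x, map_add, map_add, he₀, he₂,
      θ.counit_of_ne (by omega), zero_add]
    exact (tE.apply_symm_apply _).trans (by simp [DualNumber.trace])
  have hε' (x : DualNumber k) : poincareTrace k (e' x) = DualNumber.trace k x := by
    rw [← TrivSqZeroExt.inl_fst_add_inr_snd_eq x, map_add, map_add, he'₀, he'₂,
      SphereCohomology.poincareTrace_of_ne (by omega), zero_add]
    exact (tH.apply_symm_apply _).trans (by simp [DualNumber.trace])
  -- Both comultiplications are transported from the dual numbers, which makes `e' ∘ e⁻¹` compatible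
  -- with them.
  refine ⟨_, _, e.symm.trans e', (DualNumber.isFrobenius k).congr e hε,
    (DualNumber.isFrobenius k).congr e' hε', fun n a => ?_, LinearMap.ext fun x => ?_, ?_⟩
  · by_cases h₀ : n = 0
    · subst h₀
      obtain ⟨c, rfl⟩ := hE₀ a
      exact ⟨_, by rw [AlgEquiv.trans_apply, ← he₀, AlgEquiv.symm_apply_apply, he'₀]⟩
    by_cases h₂ : n = 2
    · subst h₂
      obtain ⟨d, rfl⟩ := tE.symm.surjective a
      exact ⟨_, by rw [AlgEquiv.trans_apply, ← he₂, AlgEquiv.symm_apply_apply, he'₂]⟩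
    have := hEn n h₀ h₂
    exact ⟨0, by rw [Subsingleton.elim a 0, map_zero, map_zero, map_zero]⟩
  · obtain ⟨y, rfl⟩ := e.surjective x
    rw [hε, ← hε']
    simp
  · have h₁ : (e.symm.trans e').toLinearMap ∘ₗ e.toLinearMap = e'.toLinearMap := by
      ext1 x
      simp
    have h₂ : e'.symm.toLinearMap ∘ₗ (e.symm.trans e').toLinearMap = e.symm.toLinearMap := by
      refine LinearMap.ext fun x => ?_
      simp
    rw [LinearMap.comp_assoc, LinearMap.comp_assoc, h₂, ← LinearMap.comp_assoc,
      ← LinearMap.comp_assoc, ← LinearMap.comp_assoc, ← TensorProduct.map_comp, h₁]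

theorem mainTheorem12 (k : Type u) [Field k] :
    -- `L₁` is a simple module, and `sphereComplex` triangulates the sphere
    IsSimpleModule (T20 k) (L₁ k) ∧
    Nonempty (geometricRealization sphereComplex ≃ₜ
      Metric.sphere (0 : EuclideanSpace ℝ (Fin 3)) 1) ∧
    -- the duality which defines the Frobenius structure of the Ext-algebra exists
    Nonempty (ExtDuality k) ∧
    ∀ θ : ExtDuality k,
      ∃ (Δ : ExtAlgebra k →ₗ[k] ExtAlgebra k ⊗[k] ExtAlgebra k)
        (ΔS : SphereCohomology k →ₗ[k] SphereCohomology k ⊗[k] SphereCohomology k)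
        (Φ : ExtAlgebra k ≃ₐ[k] SphereCohomology k),
        IsFrobenius k θ.counit Δ ∧
        IsFrobenius k (poincareTrace k) ΔS ∧
        (∀ (n : ℕ) (a : ExtSpace k n), ∃ c : SimplicialH sphereComplex k n,
          Φ (DirectSum.of (ExtSpace k) n a) = DirectSum.of (SimplicialH sphereComplex k) n c) ∧
        poincareTrace k ∘ₗ Φ.toLinearMap = θ.counit ∧
        ΔS ∘ₗ Φ.toLinearMap = TensorProduct.map Φ.toLinearMap Φ.toLinearMap ∘ₗ Δ :=
  ⟨T20.isSimpleModule_L₁ k, Tetrahedron.nonempty_homeomorph_sphere, T20.nonempty_extDuality k,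
    exists_frobenius_iso⟩

end
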